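/- Let $f\colon X\to Y$ be a holomorphic map of complex manifolds, let $x_0\in X$ and $y_0=f(x_0)$. Let $\mathcal{O}$ and $\mathcal{D}$ denote the sheaves of holomorphic functions and of holomorphic differential operators, and regard $$\mathcal{D}_{X\to Y,x_0}=\mathcal{O}_{X,x_0}\otimes_{\mathcal{O}_{Y,y_0}}\mathcal{D}_{Y,y_0}$$ as a left $\mathcal{D}_{X,x_0}$-module in the usual way: functions act by multiplication on the left factor, and a vector field $v$ acts by $v(b\otimes Q)=v(b)\otimes Q+\sum_j b\,v(y_j\circ f)\otimes\partial_{y_j}Q$ in local coordinates $(y_j)$ of $Y$ at $y_0$. Let the flat dimension of a left module be the least length of a resolution by flat left modules ($\infty$ if there is none of finite length). Then $$\operatorname{flat\text{-}dim}_{\mathcal{D}_{X,x_0}}\bigl(\mathcal{D}_{X\to Y,x_0}\bigr)\le \dim_{\mathbb{C}}X-\operatorname{rank}_{\mathbb{C}}\bigl(df(x_0)\colon T_{x_0}X\to T_{f(x_0)}Y\bigr).$$ -/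

import Mathlib

open Filter Topology
open scoped Manifold ContDiff TensorProduct

namespace DiffOp

set_option linter.unusedSectionVars false

section Algebraic

variable (k A B : Type*) [Field k] [CommRing A] [CommRing B] [Algebra k A] [Algebra k B]

/-- The ring of differential operators of a smooth `k`-algebra `A` (`k` of characteristic zero): the
subalgebra of `End_k(A)` generated by the multiplications by elements of `A` and by the
`k`-derivations of `A`. -/
def diffOps : Subalgebra k (Module.End k A) :=
  Algebra.adjoin k (Set.range (Algebra.lmul k A) ∪
    Set.range (fun v : Derivation k A A => (v : A →ₗ[k] A)))

/-- An element of `A`, as an operator of order zero. -/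
def ofFun : A →ₐ[k] diffOps k A :=
  (Algebra.lmul k A).codRestrict _ fun a =>
    Algebra.subset_adjoin (Or.inl ⟨a, rfl⟩)

/-- A derivation (vector field), as an operator of order one. -/
def ofDer (v : Derivation k A A) : diffOps k A :=
  ⟨v, Algebra.subset_adjoin (Or.inr ⟨v, rfl⟩)⟩

instance diffOps.instRing : Ring (diffOps k A) := Subalgebra.toRing _

/-- The left `A`-module structure on the differential operators: `(a • P)(g) = a * P(g)`. -/
instance diffOps.instLeftModule : Module A (diffOps k A) :=
  Module.compHom _ (ofFun k A).toRingHom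

variable {k A} in
theorem diffOps.coe_smul_apply (a : A) (P : diffOps k A) (g : A) :
    (a • P : diffOps k A).1 g = a * P.1 g := rfl

variable [Algebra A B] [IsScalarTower k A B]

/-- `P ↦ (g ↦ φ (P g))`, where `φ : A → B` is the structure map. -/
def compBase : diffOps k A →ₗ[A] (A →ₗ[k] B) where
  toFun P := (IsScalarTower.toAlgHom k A B).toLinearMap ∘ₗ P.1
  map_add' P Q := by ext g; simp
  map_smul' a P := by
    ext g
    simp [diffOps.coe_smul_apply, Algebra.smul_def]

/-- The map `B ⊗_A D(A) → Hom_k(A, B)`, `b ⊗ P ↦ (g ↦ b * φ (P g))`. -/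
def ev : B ⊗[A] diffOps k A →ₗ[B] (A →ₗ[k] B) :=
  LinearMap.liftBaseChange B (compBase k A B)

variable {k A B} in
theorem ev_tmul (b : B) (P : diffOps k A) (g : A) :
    ev k A B (b ⊗ₜ P) g = b * algebraMap A B (P.1 g) := by
  simp [ev, compBase]

/-- The condition under which post-composition with differential operators of `B` on `Hom_k(A, B)`
induces an action of `D(B)` on `B ⊗_A D(A)`. It is proved below for germs of holomorphic functions. -/
structure HasTransferAction : Prop where
  inj : Function.Injective (ev k A B)
  stable : ∀ (P : diffOps k B) (t : B ⊗[A] diffOps k A),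
    ∃ t' : B ⊗[A] diffOps k A, ev k A B t' = P.1 ∘ₗ ev k A B t

variable {k A B}

/-- The action of `D(B)` on `B ⊗_A D(A)`: `P • t` is the only element with
`ev (P • t) = P ∘ ev t`. -/
noncomputable def HasTransferAction.act (h : HasTransferAction k A B) (P : diffOps k B)
    (t : B ⊗[A] diffOps k A) : B ⊗[A] diffOps k A :=
  (h.stable P t).choose

theorem HasTransferAction.ev_act (h : HasTransferAction k A B) (P : diffOps k B)
    (t : B ⊗[A] diffOps k A) : ev k A B (h.act P t) = P.1 ∘ₗ ev k A B t :=
  (h.stable P t).choose_spec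

/-- The left `D(B)`-module `B ⊗_A D(A)`. -/
noncomputable abbrev HasTransferAction.module (h : HasTransferAction k A B) :
    Module (diffOps k B) (B ⊗[A] diffOps k A) where
  smul := h.act
  one_smul t := h.inj <| (h.ev_act 1 t).trans rfl
  mul_smul P Q t := h.inj <| by
    refine (h.ev_act (P * Q) t).trans ?_
    refine Eq.trans ?_ (h.ev_act P (h.act Q t)).symm
    rw [h.ev_act]; rfl
  smul_zero P := h.inj <| (h.ev_act P 0).trans <| by simp
  smul_add P s t := h.inj <| (h.ev_act P (s + t)).trans <| by
    refine Eq.trans ?_ (map_add (ev k A B) (h.act P s) (h.act P t)).symm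
    rw [h.ev_act, h.ev_act, map_add, LinearMap.comp_add]
  add_smul P Q t := h.inj <| (h.ev_act (P + Q) t).trans <| by
    refine Eq.trans ?_ (map_add (ev k A B) (h.act P t) (h.act Q t)).symm
    rw [h.ev_act, h.ev_act]; rfl
  zero_smul t := h.inj <| (h.ev_act 0 t).trans <| by
    rw [map_zero]; rfl

/-- Functions act by multiplication on the left factor. -/
theorem HasTransferAction.act_ofFun (h : HasTransferAction k A B) (b c : B) (Q : diffOps k A) :
    h.act (ofFun k B b) (c ⊗ₜ Q) = (b * c) ⊗ₜ Q := by
  refine h.inj ((h.ev_act _ _).trans ?_)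
  ext g
  have : (ofFun k B b).1 (c * algebraMap A B (Q.1 g)) = b * (c * algebraMap A B (Q.1 g)) := rfl
  simp [ev_tmul, this, mul_assoc]

/-- Vector fields act by the Leibniz and chain rules: if `v (φ g) = ∑ c_j φ (w_j g)`, then
`v • (b ⊗ Q) = v b ⊗ Q + ∑ b c_j ⊗ (w_j Q)`. In local coordinates `y_j` one takes `w_j = ∂/∂y_j` and
`c_j = v (φ y_j)`. -/
theorem HasTransferAction.act_ofDer (h : HasTransferAction k A B) {ι : Type*} (s : Finset ι)
    (v : Derivation k B B) (c : ι → B) (w : ι → Derivation k A A)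
    (hv : ∀ g : A, v (algebraMap A B g) = ∑ j ∈ s, c j * algebraMap A B (w j g))
    (b : B) (Q : diffOps k A) :
    h.act (ofDer k B v) (b ⊗ₜ Q) =
      v b ⊗ₜ Q + ∑ j ∈ s, (b * c j) ⊗ₜ (ofDer k A (w j) * Q) := by
  refine h.inj ((h.ev_act _ _).trans ?_)
  ext g
  simp [ev_tmul, ofDer, hv, Finset.mul_sum, mul_comm (v b), mul_assoc, add_comm]

/-- Coordinates `y` on `A` with partial derivatives `d`, such that a derivation which kills the
coordinates is zero. -/
structure Coordinates {k A : Type*} [Field k] [CommRing A] [Algebra k A] {ι : Type*}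
    [DecidableEq ι] (y : ι → A) (d : ι → Derivation k A A) : Prop where
  apply_eq : ∀ i j, d i (y j) = if i = j then 1 else 0
  separated : ∀ v : Derivation k A A, (∀ j, v (y j) = 0) → v = 0

namespace Coordinates

variable {ι : Type*} [DecidableEq ι] {y : ι → A} {d : ι → Derivation k A A}

theorem der_eq [Fintype ι] (h : Coordinates y d) (v : Derivation k A A) :
    v = ∑ j, v (y j) • d j := by
  rw [← sub_eq_zero]
  apply h.separated
  intro j
  have : (∑ i, v (y i) • d i) (y j) = ∑ i, v (y i) * d i (y j) := by
    rw [← Derivation.coeFnAddMonoidHom_apply, map_sum, Finset.sum_apply]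
    simp
  simp [this, h.apply_eq]

theorem commute (h : Coordinates y d) (i j : ι) : Commute (ofDer k A (d i)) (ofDer k A (d j)) := by
  have : ⁅d i, d j⁆ = 0 := h.separated _ fun l => by
    rw [Derivation.commutator_apply, h.apply_eq, h.apply_eq]
    split_ifs <;> simp
  apply Subtype.ext
  ext g
  have hg := congrArg (fun v : Derivation k A A => v g) this
  rw [Derivation.commutator_apply] at hg
  exact sub_eq_zero.1 hg

end Coordinates

theorem exists_polyHom {ι R : Type*} [Ring R] [Algebra k R] (d : ι → R)
    (hd : ∀ i j, Commute (d i) (d j)) :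
    ∃ Φ : MvPolynomial ι k →ₐ[k] R, ∀ j, Φ (MvPolynomial.X j) = d j := by
  have hc : ∀ a ∈ Set.range d, ∀ b ∈ Set.range d, a * b = b * a := by
    rintro _ ⟨i, rfl⟩ _ ⟨j, rfl⟩; exact hd i j
  have hcomm := Algebra.isMulCommutative_adjoin k hc
  let : CommRing (Algebra.adjoin k (Set.range d)) :=
    { (inferInstance : Ring (Algebra.adjoin k (Set.range d))) with
      mul_comm := hcomm.is_comm.comm }
  refine ⟨(Algebra.adjoin k (Set.range d)).val.comp
    (MvPolynomial.aeval fun j => ⟨d j, Algebra.subset_adjoin ⟨j, rfl⟩⟩), fun j => by simp⟩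

theorem polyHom_apply [CharZero k] {ι : Type*} [DecidableEq ι] {y : ι → A}
    {d : ι → Derivation k A A} (hy : ∀ i j, d i (y j) = if i = j then 1 else 0)
    (Φ : MvPolynomial ι k →ₐ[k] diffOps k A)
    (hΦ : ∀ j, Φ (MvPolynomial.X j) = ofDer k A (d j)) (β : ι →₀ ℕ) :
    ∀ γ : ι →₀ ℕ,
      (¬ β ≤ γ → (Φ (MvPolynomial.monomial β 1)).1 (MvPolynomial.aeval y
        (MvPolynomial.monomial γ (1 : k))) = 0) ∧
      (β = γ → ∃ c : k, c ≠ 0 ∧ (Φ (MvPolynomial.monomial β 1)).1 (MvPolynomial.aeval y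
        (MvPolynomial.monomial γ (1 : k))) = algebraMap k A c) := by
  have key : ∀ j (p : MvPolynomial ι k),
      d j (MvPolynomial.aeval y p) = MvPolynomial.aeval y (MvPolynomial.pderiv j p) := by
    intro j p
    induction p using MvPolynomial.induction_on with
    | C a => simp
    | add p q hp hq => simp [hp, hq]
    | mul_X p i hp =>
      simp only [map_mul, MvPolynomial.aeval_X, Derivation.leibniz, hp, hy, smul_eq_mul,
        MvPolynomial.pderiv_X, map_add, Pi.single_apply, eq_comm (a := i)]
      split_ifs <;> simp
  have step : ∀ j (γ : ι →₀ ℕ), d j (MvPolynomial.aeval y (MvPolynomial.monomial γ (1 : k))) =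
      (γ j : k) • MvPolynomial.aeval y (MvPolynomial.monomial (γ - Finsupp.single j 1) (1 : k)) := by
    intro j γ
    rw [key, MvPolynomial.pderiv_monomial, ← map_smul, MvPolynomial.smul_monomial]
    simp
  induction hn : β.degree generalizing β with
  | zero =>
    rw [Finsupp.degree_eq_zero_iff] at hn
    subst hn
    refine fun γ => ⟨fun h => absurd (zero_le : (0 : ι →₀ ℕ) ≤ γ) h, fun h => ⟨1, one_ne_zero, ?_⟩⟩
    subst h
    simp [← MvPolynomial.C_apply]
  | succ n ih =>
    obtain ⟨j, hj⟩ : ∃ j, β j ≠ 0 := by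
      by_contra! h
      have : β = 0 := Finsupp.ext h
      simp [this] at hn
    obtain ⟨β', rfl⟩ : ∃ β', β = β' + Finsupp.single j 1 :=
      ⟨β - Finsupp.single j 1, (tsub_add_cancel_of_le (by simpa using Nat.one_le_iff_ne_zero.2 hj)).symm⟩
    have hn' : β'.degree = n := by simpa using hn
    have hmon : ∀ g : A, (Φ (MvPolynomial.monomial (β' + Finsupp.single j 1) 1)).1 g =
        (Φ (MvPolynomial.monomial β' 1)).1 (d j g) := by
      intro g
      have : MvPolynomial.monomial (β' + Finsupp.single j 1) (1 : k) =
          MvPolynomial.monomial β' 1 * MvPolynomial.X j := by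
        rw [MvPolynomial.X, MvPolynomial.monomial_mul, one_mul]
      rw [this, map_mul, hΦ]
      rfl
    intro γ
    rw [hmon, step, map_smul]
    by_cases h0 : γ j = 0
    · refine ⟨fun _ => by simp [h0], fun h => ?_⟩
      subst h
      simp at h0
    · obtain ⟨γ', rfl⟩ : ∃ γ', γ = γ' + Finsupp.single j 1 :=
        ⟨γ - Finsupp.single j 1, (tsub_add_cancel_of_le (by simpa using Nat.one_le_iff_ne_zero.2 h0)).symm⟩
      rw [add_tsub_cancel_right, add_le_add_iff_right, add_left_inj]
      refine ⟨fun h => by rw [(ih β' hn' γ').1 h, smul_zero], fun h => ?_⟩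
      obtain ⟨c, hc, he⟩ := (ih β' hn' γ').2 h
      refine ⟨((γ' + Finsupp.single j 1 : ι →₀ ℕ) j : k) * c,
        mul_ne_zero (by exact_mod_cast h0) hc, ?_⟩
      rw [he, map_mul, Algebra.smul_def]

theorem Coordinates.mem_span {ι : Type*} [DecidableEq ι] [Fintype ι] {y : ι → A}
    {d : ι → Derivation k A A} (h : Coordinates y d)
    (Φ : MvPolynomial ι k →ₐ[k] diffOps k A)
    (hΦ : ∀ j, Φ (MvPolynomial.X j) = ofDer k A (d j)) (P : diffOps k A) :
    P ∈ Submodule.span A (Set.range Φ) := by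
  have hfun : ∀ (a : A) (Q : diffOps k A), ofFun k A a * Q = a • Q := fun _ _ => rfl
  have hd : ∀ (j : ι) (s : diffOps k A), s ∈ Submodule.span A (Set.range Φ) →
      ofDer k A (d j) * s ∈ Submodule.span A (Set.range Φ) := by
    intro j s hs
    induction hs using Submodule.span_induction with
    | mem x hx =>
      obtain ⟨p, rfl⟩ := hx
      exact Submodule.subset_span ⟨MvPolynomial.X j * p, by rw [map_mul, hΦ]⟩
    | zero => simp
    | add x z _ _ hx hz => rw [mul_add]; exact add_mem hx hz
    | smul a x hx' hx =>
      have : ofDer k A (d j) * (a • x) = a • (ofDer k A (d j) * x) + d j a • x := by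
        apply Subtype.ext
        ext g
        change d j (a * x.1 g) = a * d j (x.1 g) + d j a * x.1 g
        rw [Derivation.leibniz, smul_eq_mul, smul_eq_mul, mul_comm (x.1 g)]
      rw [this]
      exact add_mem (Submodule.smul_mem _ _ hx) (Submodule.smul_mem _ _ hx')
  have main : ∀ Q : Module.End k A, ∀ hQ : Q ∈ diffOps k A, ∀ s ∈ Submodule.span A (Set.range Φ),
      (⟨Q, hQ⟩ : diffOps k A) * s ∈ Submodule.span A (Set.range Φ) := by
    intro Q hQ
    induction hQ using Algebra.adjoin_induction with
    | mem x hx =>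
      intro s hs
      rcases hx with ⟨a, rfl⟩ | ⟨v, rfl⟩
      · exact Submodule.smul_mem _ a hs
      · have : (ofDer k A v) * s = ∑ j, v (y j) • (ofDer k A (d j) * s) := by
          apply Subtype.ext
          ext g
          have hg := congrArg (fun w : Derivation k A A => w (s.1 g)) (h.der_eq v)
          simp only [← Derivation.coeFnAddMonoidHom_apply, map_sum, Finset.sum_apply] at hg
          rw [AddSubmonoidClass.coe_finsetSum, LinearMap.sum_apply]
          exact hg
        change ofDer k A v * s ∈ _
        rw [this]
        exact Submodule.sum_mem _ fun j _ => Submodule.smul_mem _ _ (hd j s hs)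
    | algebraMap r =>
      intro s hs
      have : (⟨algebraMap k _ r, Subalgebra.algebraMap_mem _ r⟩ : diffOps k A) * s =
          algebraMap k A r • s := by
        apply Subtype.ext
        ext g
        change r • s.1 g = algebraMap k A r * s.1 g
        rw [Algebra.smul_def]
      rw [this]
      exact Submodule.smul_mem _ _ hs
    | add x z hx hz ihx ihz =>
      intro s hs
      have : (⟨x + z, add_mem hx hz⟩ : diffOps k A) * s = (⟨x, hx⟩ : diffOps k A) * s + (⟨z, hz⟩ : diffOps k A) * s :=
        add_mul (⟨x, hx⟩ : diffOps k A) ⟨z, hz⟩ s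
      rw [this]
      exact add_mem (ihx s hs) (ihz s hs)
    | mul x z hx hz ihx ihz =>
      intro s hs
      have : (⟨x * z, mul_mem hx hz⟩ : diffOps k A) * s = (⟨x, hx⟩ : diffOps k A) * ((⟨z, hz⟩ : diffOps k A) * s) :=
        mul_assoc (⟨x, hx⟩ : diffOps k A) ⟨z, hz⟩ s
      rw [this]
      exact ihx _ (ihz s hs)
  have h1 := main P.1 P.2 1 (Submodule.subset_span ⟨1, map_one Φ⟩)
  rwa [mul_one] at h1

theorem Coordinates.exists_sum {ι : Type*} [DecidableEq ι] [Fintype ι] {y : ι → A}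
    {d : ι → Derivation k A A} (h : Coordinates y d)
    (Φ : MvPolynomial ι k →ₐ[k] diffOps k A)
    (hΦ : ∀ j, Φ (MvPolynomial.X j) = ofDer k A (d j)) (t : B ⊗[A] diffOps k A) :
    ∃ c : (ι →₀ ℕ) →₀ B, t = c.sum fun β b => b ⊗ₜ Φ (MvPolynomial.monomial β 1) := by
  let L : ((ι →₀ ℕ) →₀ B) →ₗ[B] B ⊗[A] diffOps k A :=
    Finsupp.linearCombination B fun β => (1 : B) ⊗ₜ[A] Φ (MvPolynomial.monomial β 1)
  suffices t ∈ LinearMap.range L by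
    obtain ⟨c, rfl⟩ := this
    refine ⟨c, ?_⟩
    simp [L, Finsupp.linearCombination_apply, TensorProduct.smul_tmul']
  induction t using TensorProduct.induction_on with
  | zero => exact zero_mem _
  | add x z hx hz => exact add_mem hx hz
  | tmul b P =>
    have hP := h.mem_span Φ hΦ P
    induction hP using Submodule.span_induction generalizing b with
    | zero => simp
    | add x z _ _ hx hz => rw [TensorProduct.tmul_add]; exact add_mem (hx b) (hz b)
    | smul a x _ hx => rw [← TensorProduct.smul_tmul]; exact hx _
    | mem x hx =>
      obtain ⟨p, rfl⟩ := hx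
      induction p using MvPolynomial.induction_on' with
      | add p q hp hq => rw [map_add, TensorProduct.tmul_add]; exact add_mem hp hq
      | monomial β r =>
        refine ⟨Finsupp.single β (r • b), ?_⟩
        have : MvPolynomial.monomial β r = r • MvPolynomial.monomial β (1 : k) := by
          simp [MvPolynomial.smul_monomial]
        rw [this, map_smul]
        have h2 : r • Φ (MvPolynomial.monomial β 1) =
            algebraMap k A r • Φ (MvPolynomial.monomial β 1) := by
          apply Subtype.ext
          ext g
          exact Algebra.smul_def _ _
        rw [h2, ← TensorProduct.smul_tmul]
        simp [L, TensorProduct.smul_tmul']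

theorem Coordinates.hasTransferAction [CharZero k] {ι : Type*} [DecidableEq ι] [Fintype ι]
    {y : ι → A} {d : ι → Derivation k A A} (h : Coordinates y d)
    (hB : ∀ w : Derivation k A B, (∀ j, w (y j) = 0) → w = 0) : HasTransferAction k A B where
  inj := by
    obtain ⟨Φ, hΦ⟩ := exists_polyHom (k := k) (fun j => ofDer k A (d j)) h.commute
    rw [injective_iff_map_eq_zero]
    intro t ht
    obtain ⟨c, rfl⟩ := h.exists_sum Φ hΦ t
    by_contra hne
    have hc : c.support.Nonempty := by
      rw [Finset.nonempty_iff_ne_empty]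
      intro h0
      rw [Finsupp.support_eq_empty] at h0
      simp [h0] at hne
    obtain ⟨γ, hγ⟩ := c.support.exists_minimal hc
    have he := LinearMap.congr_fun ht (MvPolynomial.aeval y (MvPolynomial.monomial γ (1 : k)))
    obtain ⟨r, hr, hr'⟩ := (polyHom_apply h.apply_eq Φ hΦ γ γ).2 rfl
    rw [Finsupp.sum, map_sum, LinearMap.sum_apply, Finset.sum_eq_single γ] at he
    · rw [ev_tmul, hr', ← IsScalarTower.algebraMap_apply, mul_comm, ← Algebra.smul_def] at he
      exact Finsupp.mem_support_iff.1 hγ.prop ((smul_eq_zero_iff_right hr).1 he)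
    · intro β hβ hne
      rw [ev_tmul, (polyHom_apply h.apply_eq Φ hΦ β γ).1, map_zero, mul_zero]
      exact fun hle => hne (le_antisymm hle (hγ.le_of_le hβ hle))
    · exact fun hn => absurd hγ.prop hn
  stable := by
    rintro ⟨P, hP⟩
    induction hP using Algebra.adjoin_induction with
    | algebraMap r =>
      intro t
      refine ⟨algebraMap k B r • t, ?_⟩
      rw [map_smul]
      ext g
      simp [Algebra.smul_def, Module.algebraMap_end_apply]
    | add x z hx hz ihx ihz =>
      intro t
      obtain ⟨t1, h1⟩ := ihx t
      obtain ⟨t2, h2⟩ := ihz t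
      exact ⟨t1 + t2, by rw [map_add, h1, h2]; rfl⟩
    | mul x z hx hz ihx ihz =>
      intro t
      obtain ⟨t1, h1⟩ := ihz t
      obtain ⟨t2, h2⟩ := ihx t1
      exact ⟨t2, by rw [h2, h1]; rfl⟩
    | mem x hx =>
      intro t
      rcases hx with ⟨b, rfl⟩ | ⟨v, rfl⟩
      · exact ⟨b • t, by rw [map_smul]; rfl⟩
      · have hv : ∀ g : A, v (algebraMap A B g) =
            ∑ j, v (algebraMap A B (y j)) * algebraMap A B (d j g) := by
          let w : Derivation k A B := v.compAlgebraMap A -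
            ∑ j, v (algebraMap A B (y j)) • (Algebra.linearMap A B).compDer (d j)
          have hw : ∀ g, w g = v (algebraMap A B g) -
              ∑ j, v (algebraMap A B (y j)) * algebraMap A B (d j g) := by
            intro g
            simp only [w, Derivation.sub_apply, ← Derivation.coeFnAddMonoidHom_apply, map_sum,
              Finset.sum_apply]
            rfl
          have h0 : w = 0 := hB w fun j => by
            rw [hw]
            simp [h.apply_eq, apply_ite]
          intro g
          have := hw g
          rw [h0] at this
          exact (sub_eq_zero.1 this.symm)
        induction t using TensorProduct.induction_on with
        | zero => exact ⟨0, by simp⟩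
        | add s t hs ht =>
          obtain ⟨t1, h1⟩ := hs
          obtain ⟨t2, h2⟩ := ht
          exact ⟨t1 + t2, by rw [map_add, map_add, h1, h2, LinearMap.comp_add]⟩
        | tmul b Q =>
          refine ⟨v b ⊗ₜ Q + ∑ j, (b * v (algebraMap A B (y j))) ⊗ₜ (ofDer k A (d j) * Q), ?_⟩
          ext g
          rw [map_add, map_sum, LinearMap.add_apply, LinearMap.sum_apply, ev_tmul]
          have h1 : ((⟨_, Algebra.subset_adjoin (Or.inr ⟨v, rfl⟩)⟩ : diffOps k B).1 ∘ₗ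
              ev k A B (b ⊗ₜ[A] Q)) g = v (b * algebraMap A B (Q.1 g)) := by
            rw [← ev_tmul]; rfl
          have h2 : ∀ j, ev k A B ((b * v (algebraMap A B (y j))) ⊗ₜ[A] (ofDer k A (d j) * Q)) g =
              b * (v (algebraMap A B (y j)) * algebraMap A B (d j (Q.1 g))) := by
            intro j; rw [ev_tmul, mul_assoc]; rfl
          rw [h1, Derivation.leibniz, hv, Finset.sum_congr rfl fun j _ => h2 j, ← Finset.mul_sum,
            smul_eq_mul, smul_eq_mul, mul_comm (v b), add_comm]

end Algebraic

noncomputable section Germs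

instance germAlgebra {α : Type*} (l : Filter α) : Algebra ℂ (Germ l ℂ) :=
  Algebra.ofModule
    (fun r p q => Germ.inductionOn₂ p q fun f g => congrArg _ (funext fun x => by simp [mul_assoc]))
    (fun r p q => Germ.inductionOn₂ p q fun f g => congrArg _ (funext fun x => by
      simp [mul_left_comm]))

theorem germ_algebraMap {α : Type*} (l : Filter α) (c : ℂ) :
    algebraMap ℂ (Germ l ℂ) c = ((fun _ => c : α → ℂ) : Germ l ℂ) := by
  rw [Algebra.algebraMap_eq_smul_one]
  exact congrArg _ (funext fun x => by simp)

variable {E : Type*} [NormedAddCommGroup E] [NormedSpace ℂ E]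
  {F : Type*} [NormedAddCommGroup F] [NormedSpace ℂ F]
  {X : Type*} [TopologicalSpace X] [ChartedSpace E X]
  {Y : Type*} [TopologicalSpace Y] [ChartedSpace F Y]

variable (E) in
/-- The ring `O_{X,x}` of germs at `x` of holomorphic functions on the complex manifold `X` modelled
on `E`. -/
def holGerms (x : X) : Subalgebra ℂ (Germ (𝓝 x) ℂ) where
  carrier := {p | ∃ g : X → ℂ, ContMDiffAt 𝓘(ℂ, E) 𝓘(ℂ) ω g x ∧ p = (g : Germ (𝓝 x) ℂ)}
  mul_mem' := by
    rintro _ _ ⟨g, hg, rfl⟩ ⟨h, hh, rfl⟩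
    exact ⟨g * h, hg.mul hh, rfl⟩
  add_mem' := by
    rintro _ _ ⟨g, hg, rfl⟩ ⟨h, hh, rfl⟩
    exact ⟨g + h, hg.add hh, rfl⟩
  algebraMap_mem' c := ⟨fun _ => c, contMDiffAt_const, germ_algebraMap _ c⟩

instance holGerms.instCommRing (x : X) : CommRing (holGerms E x) := Subalgebra.toCommRing _

instance holGerms.instAlgebra (x : X) : Algebra ℂ (holGerms E x) := Subalgebra.algebra _

/-- The pullback `O_{Y,f(x)} → O_{X,x}`, `g ↦ g ∘ f`. -/
def pullback {f : X → Y} {x : X} (hf : ContMDiffAt 𝓘(ℂ, E) 𝓘(ℂ, F) ω f x) :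
    holGerms F (f x) →ₐ[ℂ] holGerms E x where
  toFun p := ⟨p.1.compTendsto f hf.continuousAt, by
    obtain ⟨_, g, hg, rfl⟩ := p
    exact ⟨g ∘ f, hg.comp x hf, rfl⟩⟩
  map_one' := rfl
  map_mul' p q := Subtype.ext <| by
    obtain ⟨_, g, hg, rfl⟩ := p
    obtain ⟨_, h, hh, rfl⟩ := q
    rfl
  map_zero' := rfl
  map_add' p q := Subtype.ext <| by
    obtain ⟨_, g, hg, rfl⟩ := p
    obtain ⟨_, h, hh, rfl⟩ := q
    rfl
  commutes' c := Subtype.ext <| by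
    change Germ.compTendsto (algebraMap ℂ (Germ (𝓝 (f x)) ℂ) c) f hf.continuousAt =
      algebraMap ℂ (Germ (𝓝 x) ℂ) c
    rw [germ_algebraMap, germ_algebraMap]
    rfl

section Model

variable [IsManifold 𝓘(ℂ, E) ω X] {x : X}

theorem contMDiffAt_comp_chart {G : E → ℂ} (hG : AnalyticAt ℂ G (extChartAt 𝓘(ℂ, E) x x)) :
    ContMDiffAt 𝓘(ℂ, E) 𝓘(ℂ) ω (G ∘ extChartAt 𝓘(ℂ, E) x) x :=
  ContMDiffAt.comp x hG.contDiffAt.contMDiffAt contMDiffAt_extChartAt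

/-- The germ of `G` read in the preferred chart at `x`. -/
def ofChart (G : E → ℂ) (hG : AnalyticAt ℂ G (extChartAt 𝓘(ℂ, E) x x)) : holGerms E x :=
  ⟨((G ∘ extChartAt 𝓘(ℂ, E) x : X → ℂ) : Germ (𝓝 x) ℂ), _, contMDiffAt_comp_chart hG, rfl⟩

theorem exists_ofChart (p : holGerms E x) :
    ∃ G, ∃ hG : AnalyticAt ℂ G (extChartAt 𝓘(ℂ, E) x x), p = ofChart G hG := by
  obtain ⟨_, g, hg, rfl⟩ := p
  have hsymm : ContMDiffAt 𝓘(ℂ, E) 𝓘(ℂ, E) ω (extChartAt 𝓘(ℂ, E) x).symm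
      (extChartAt 𝓘(ℂ, E) x x) :=
    (contMDiffOn_extChartAt_symm x).contMDiffAt (extChartAt_target_mem_nhds x)
  have hg' : ContMDiffAt 𝓘(ℂ, E) 𝓘(ℂ) ω g
      ((extChartAt 𝓘(ℂ, E) x).symm (extChartAt 𝓘(ℂ, E) x x)) := by
    rwa [extChartAt_to_inv]
  refine ⟨g ∘ (extChartAt 𝓘(ℂ, E) x).symm, ?_, Subtype.ext (Germ.coe_eq.2 ?_)⟩
  · exact (hg'.comp _ hsymm).contDiffAt.analyticAt
  · filter_upwards [extChartAt_source_mem_nhds (I := 𝓘(ℂ, E)) x] with z hz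
    exact congrArg g (PartialEquiv.left_inv _ hz).symm

theorem ofChart_inj {G H : E → ℂ} {hG : AnalyticAt ℂ G (extChartAt 𝓘(ℂ, E) x x)}
    {hH : AnalyticAt ℂ H (extChartAt 𝓘(ℂ, E) x x)} :
    ofChart G hG = ofChart H hH ↔ G =ᶠ[𝓝 (extChartAt 𝓘(ℂ, E) x x)] H := by
  have hc : Tendsto (extChartAt 𝓘(ℂ, E) x) (𝓝 x) (𝓝 (extChartAt 𝓘(ℂ, E) x x)) :=
    continuousAt_extChartAt x
  have hs : Tendsto (extChartAt 𝓘(ℂ, E) x).symm (𝓝 (extChartAt 𝓘(ℂ, E) x x)) (𝓝 x) := by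
    have := continuousAt_extChartAt_symm (I := 𝓘(ℂ, E)) x
    rwa [ContinuousAt, extChartAt_to_inv] at this
  refine ⟨fun h => ?_, fun h => Subtype.ext (Germ.coe_eq.2 (hc.eventually h))⟩
  have h1 := hs.eventually (Germ.coe_eq.1 (Subtype.ext_iff.1 h))
  filter_upwards [h1, extChartAt_target_mem_nhds (I := 𝓘(ℂ, E)) x] with z hz hz'
  simpa only [Function.comp_apply, PartialEquiv.right_inv _ hz'] using hz

theorem ofChart_add {G H : E → ℂ} (hG : AnalyticAt ℂ G (extChartAt 𝓘(ℂ, E) x x))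
    (hH : AnalyticAt ℂ H (extChartAt 𝓘(ℂ, E) x x)) :
    ofChart G hG + ofChart H hH = ofChart (G + H) (hG.add hH) := rfl

theorem ofChart_mul {G H : E → ℂ} (hG : AnalyticAt ℂ G (extChartAt 𝓘(ℂ, E) x x))
    (hH : AnalyticAt ℂ H (extChartAt 𝓘(ℂ, E) x x)) :
    ofChart G hG * ofChart H hH = ofChart (G * H) (hG.mul hH) := rfl

theorem ofChart_const (c : ℂ) :
    ofChart (fun _ => c) analyticAt_const = algebraMap ℂ (holGerms E x) c :=
  Subtype.ext (germ_algebraMap _ c).symm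

theorem ofChart_smul (c : ℂ) {G : E → ℂ} (hG : AnalyticAt ℂ G (extChartAt 𝓘(ℂ, E) x x)) :
    c • ofChart G hG = ofChart (c • G) (analyticAt_const.smul hG) := rfl

theorem ofChart_sum {ι : Type*} (s : Finset ι) {G : ι → E → ℂ}
    (hG : ∀ i, AnalyticAt ℂ (G i) (extChartAt 𝓘(ℂ, E) x x)) :
    ∑ i ∈ s, ofChart (G i) (hG i) = ofChart (∑ i ∈ s, G i) (s.analyticAt_sum fun i _ => hG i) := by
  classical
  induction s using Finset.induction_on with
  | empty => simp only [Finset.sum_empty]; rfl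
  | insert a s ha ih => simp only [Finset.sum_insert ha, ih]; rfl

variable [FiniteDimensional ℂ E]

theorem analyticAt_dir {G : E → ℂ} {e : E} (hG : AnalyticAt ℂ G e) (v : E) :
    AnalyticAt ℂ (fun z => fderiv ℂ G z v) e :=
  ((ContinuousLinearMap.apply ℂ ℂ v).analyticAt _).comp hG.fderiv

variable (x) in
/-- The function underlying `dirDer`. -/
def dirFun (v : E) (p : holGerms E x) : holGerms E x :=
  ofChart _ (analyticAt_dir (exists_ofChart p).choose_spec.choose v)

theorem dirFun_ofChart (v : E) {G : E → ℂ} (hG : AnalyticAt ℂ G (extChartAt 𝓘(ℂ, E) x x)) :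
    dirFun x v (ofChart G hG) = ofChart _ (analyticAt_dir hG v) := by
  refine ofChart_inj.2 ?_
  have h := ofChart_inj.1 (exists_ofChart (ofChart G hG)).choose_spec.choose_spec
  filter_upwards [h.eventuallyEq_nhds] with z hz
  rw [hz.fderiv_eq]

variable (x) in
/-- The partial derivative in the direction `v`, in the preferred chart at `x`. -/
def dirDer (v : E) : Derivation ℂ (holGerms E x) (holGerms E x) :=
  Derivation.mk'
    { toFun := dirFun x v
      map_add' := fun p q => by
        obtain ⟨G, hG, rfl⟩ := exists_ofChart p
        obtain ⟨H, hH, rfl⟩ := exists_ofChart q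
        rw [ofChart_add, dirFun_ofChart, dirFun_ofChart, dirFun_ofChart, ofChart_add, ofChart_inj]
        filter_upwards [hG.eventually_analyticAt, hH.eventually_analyticAt] with z h1 h2
        simp [fderiv_add h1.differentiableAt h2.differentiableAt]
      map_smul' := fun c p => by
        obtain ⟨G, hG, rfl⟩ := exists_ofChart p
        rw [RingHom.id_apply, ofChart_smul, dirFun_ofChart, dirFun_ofChart, ofChart_smul,
          ofChart_inj]
        filter_upwards [hG.eventually_analyticAt] with z h1
        simp [fderiv_const_smul h1.differentiableAt] }
    fun p q => by
      obtain ⟨G, hG, rfl⟩ := exists_ofChart p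
      obtain ⟨H, hH, rfl⟩ := exists_ofChart q
      simp only [LinearMap.coe_mk, AddHom.coe_mk, smul_eq_mul]
      rw [ofChart_mul, dirFun_ofChart, dirFun_ofChart, dirFun_ofChart, ofChart_mul, ofChart_mul,
        ofChart_add, ofChart_inj]
      filter_upwards [hG.eventually_analyticAt, hH.eventually_analyticAt] with z h1 h2
      simp [fderiv_mul h1.differentiableAt h2.differentiableAt]

theorem analyticAt_coord {ι : Type*} (b : Module.Basis ι ℂ E) (j : ι) (e : E) :
    AnalyticAt ℂ (fun z => b.coord j (z - e)) e := by
  have : AnalyticAt ℂ (fun z => (LinearMap.toContinuousLinearMap (b.coord j)) (z - e)) e :=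
    ((LinearMap.toContinuousLinearMap (b.coord j)).analyticAt _).comp
      (analyticAt_id.sub analyticAt_const)
  exact this

variable (x) in
/-- The `j`-th coordinate function of the preferred chart at `x`, centred at `x`. -/
def coordGerm {ι : Type*} (b : Module.Basis ι ℂ E) (j : ι) : holGerms E x :=
  ofChart _ (analyticAt_coord b j (extChartAt 𝓘(ℂ, E) x x))

theorem dirDer_coordGerm {ι : Type*} [DecidableEq ι] (b : Module.Basis ι ℂ E) (i j : ι) :
    dirDer x (b i) (coordGerm x b j) = if i = j then 1 else 0 := by
  have : dirDer x (b i) (coordGerm x b j) = ofChart (fun _ => if i = j then 1 else 0)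
      analyticAt_const := by
    refine (dirFun_ofChart _ _).trans (ofChart_inj.2 (Eventually.of_forall fun z => ?_))
    change fderiv ℂ (fun z => (LinearMap.toContinuousLinearMap (b.coord j))
      (z - extChartAt 𝓘(ℂ, E) x x)) z (b i) = _
    rw [fderiv_comp_sub (f := (LinearMap.toContinuousLinearMap (b.coord j))),
      ContinuousLinearMap.fderiv]
    simp [Finsupp.single_apply]
  rw [this, ofChart_const]
  split_ifs <;> simp

theorem hadamard {G : E → ℂ} {e : E} (hG : AnalyticAt ℂ G e) :
    ∃ Q : E → (E →L[ℂ] ℂ), AnalyticAt ℂ Q e ∧ G =ᶠ[𝓝 e] fun z => G e + Q z (z - e) := by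
  obtain ⟨p, r, hp⟩ := hG
  have hrad : p.shift.radius = p.radius := p.radius_shift
  have hpos : 0 < p.shift.radius := hrad ▸ hp.r_pos.trans_le hp.r_le
  have hQ := p.shift.hasFPowerSeriesOnBall hpos
  have hQ' : HasFPowerSeriesOnBall (fun z => p.shift.sum (z - e)) p.shift e p.shift.radius := by
    simpa using hQ.comp_sub e
  have hU := hQ'.unshift (z := G e)
  refine ⟨_, hQ'.analyticAt, ?_⟩
  have he : p.shift.unshift (G e) = p := by
    ext n v
    cases n with
    | zero =>
      rw [FormalMultilinearSeries.unshift, ← hp.coeff_zero v]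
      rfl
    | succ n =>
      simp [FormalMultilinearSeries.unshift, FormalMultilinearSeries.shift]
  rw [he] at hU
  have h1 := hp.hasFPowerSeriesAt
  have h2 := hU.hasFPowerSeriesAt
  have h3 := h1.eventually_hasSum_sub
  have h4 := h2.eventually_hasSum_sub
  filter_upwards [h3, h4] with z hz hz'
  exact hz.unique hz'

theorem hadamard_germ {ι : Type*} [Fintype ι] (b : Module.Basis ι ℂ E) (p : holGerms E x) :
    ∃ (c : ℂ) (q : ι → holGerms E x), p = algebraMap ℂ _ c + ∑ j, coordGerm x b j * q j := by
  obtain ⟨G, hG, rfl⟩ := exists_ofChart p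
  obtain ⟨Q, hQ, hGQ⟩ := hadamard hG
  have hq : ∀ j, AnalyticAt ℂ (fun z => Q z (b j)) (extChartAt 𝓘(ℂ, E) x x) := fun j =>
    ((ContinuousLinearMap.apply ℂ ℂ (b j)).analyticAt _).comp hQ
  refine ⟨G (extChartAt 𝓘(ℂ, E) x x), fun j => ofChart _ (hq j), ?_⟩
  have hm : ∀ j, coordGerm x b j * ofChart _ (hq j) = ofChart _ ((analyticAt_coord b j _).mul (hq j)) :=
    fun j => rfl
  simp only [hm]
  rw [ofChart_sum, ← ofChart_const, ofChart_add, ofChart_inj]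
  filter_upwards [hGQ] with z hz
  rw [hz]
  conv_lhs => rw [← b.sum_repr (z - extChartAt 𝓘(ℂ, E) x x)]
  simp

/-- The germ vanishes to order at least `k` at `x`. -/
def VanishOrder (k : ℕ) (p : holGerms E x) : Prop :=
  ∃ G, ∃ hG : AnalyticAt ℂ G (extChartAt 𝓘(ℂ, E) x x), p = ofChart G hG ∧
    G =O[𝓝 (extChartAt 𝓘(ℂ, E) x x)] fun z => ‖z - extChartAt 𝓘(ℂ, E) x x‖ ^ k

theorem VanishOrder.mul {k l : ℕ} {p q : holGerms E x} (hp : VanishOrder k p)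
    (hq : VanishOrder l q) : VanishOrder (k + l) (p * q) := by
  obtain ⟨G, hG, rfl, h1⟩ := hp
  obtain ⟨H, hH, rfl, h2⟩ := hq
  refine ⟨_, _, ofChart_mul hG hH, ?_⟩
  simpa only [pow_add] using! h1.mul h2

theorem VanishOrder.sum {ι : Type*} (s : Finset ι) {k : ℕ} {p : ι → holGerms E x}
    (hp : ∀ i, VanishOrder k (p i)) : VanishOrder k (∑ i ∈ s, p i) := by
  choose G hG h1 h2 using hp
  refine ⟨_, s.analyticAt_sum fun i _ => hG i, ?_, ?_⟩
  · simp only [h1]; exact ofChart_sum s hG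
  · have := Asymptotics.IsBigO.sum (s := s) fun i _ => h2 i
    simpa [Finset.sum_fn] using this

theorem vanishOrder_zero (p : holGerms E x) : VanishOrder 0 p := by
  obtain ⟨G, hG, rfl⟩ := exists_ofChart p
  refine ⟨G, hG, rfl, ?_⟩
  simpa using hG.continuousAt.norm.isBoundedUnder_le.isBigO_one ℝ

theorem vanishOrder_one {G : E → ℂ} (hG : AnalyticAt ℂ G (extChartAt 𝓘(ℂ, E) x x))
    (h0 : G (extChartAt 𝓘(ℂ, E) x x) = 0) : VanishOrder 1 (ofChart G hG) := by
  refine ⟨G, hG, rfl, ?_⟩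
  have := hG.differentiableAt.isBigO_sub.norm_right
  simpa only [h0, sub_zero, pow_one] using this

theorem eq_zero_of_vanishOrder {p : holGerms E x} (hp : ∀ k, VanishOrder k p) : p = 0 := by
  obtain ⟨G, hG, rfl⟩ := exists_ofChart p
  have hO : ∀ k : ℕ, G =O[𝓝 (extChartAt 𝓘(ℂ, E) x x)]
      fun z => ‖z - extChartAt 𝓘(ℂ, E) x x‖ ^ k := by
    intro k
    obtain ⟨H, hH, he, h⟩ := hp k
    exact (ofChart_inj.1 he).trans_isBigO h
  change ofChart G hG = ofChart (fun _ => 0) analyticAt_const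
  rw [ofChart_inj]
  obtain ⟨P, hP⟩ := hG
  set e := extChartAt 𝓘(ℂ, E) x x
  have hz : ∀ n, ∀ v : E, P n (fun _ => v) = 0 := by
    intro n
    induction n using Nat.strong_induction_on with
    | _ n ih =>
      have h1 := hP.isBigO_sub_partialSum_pow (n + 1)
      have h2 : P.partialSum (n + 1) = fun v => P n fun _ => v := by
        funext v
        refine Finset.sum_eq_single _ (fun m hm hne => ?_) fun hn => ?_
        · exact ih m (lt_of_le_of_ne (Nat.lt_succ_iff.1 (Finset.mem_range.1 hm)) hne) v
        · exact absurd (Finset.mem_range.2 (Nat.lt_succ_self n)) hn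
      have ht : Tendsto (fun v : E => e + v) (𝓝 0) (𝓝 e) := by
        have : Continuous fun v : E => e + v := by fun_prop
        simpa using this.tendsto 0
      have h3 := (hO (n + 1)).comp_tendsto ht
      have h4 : (fun v => G (e + v)) =O[𝓝 0] fun v : E => ‖v‖ ^ (n + 1) := by
        simpa [Function.comp_def] using! h3
      have h5 := h4.sub h1
      rw [h2] at h5
      refine Asymptotics.IsBigO.continuousMultilinearMap_apply_eq_zero ?_
      simpa using h5
  have := hP.eventually_hasSum_sub
  filter_upwards [this] with z hz'
  have h0 : (fun n => P n fun _ => z - e) = fun _ => (0 : ℂ) := funext fun n => hz n _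
  rw [h0] at hz'
  exact hz'.unique hasSum_zero

theorem eq_zero_of_leibniz {Y : Type*} [TopologicalSpace Y] [ChartedSpace F Y]
    [IsManifold 𝓘(ℂ, F) ω Y] [FiniteDimensional ℂ F] {y : Y} {ι : Type*} [Fintype ι]
    (b : Module.Basis ι ℂ F) (φ : holGerms F y →ₐ[ℂ] holGerms E x)
    (hφ : ∀ j, VanishOrder 1 (φ (coordGerm y b j)))
    (w : holGerms F y →ₗ[ℂ] holGerms E x) (hw1 : w 1 = 0)
    (hw : ∀ p q, w (p * q) = φ p * w q + φ q * w p)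
    (hwb : ∀ j, w (coordGerm y b j) = 0) (p : holGerms F y) : w p = 0 := by
  suffices ∀ k, ∀ p, VanishOrder k (w p) from eq_zero_of_vanishOrder fun k => this k p
  intro k
  induction k with
  | zero => exact fun p => vanishOrder_zero _
  | succ k ih =>
    intro p
    obtain ⟨c, q, rfl⟩ := hadamard_germ b p
    rw [map_add, Algebra.algebraMap_eq_smul_one, map_smul, hw1, smul_zero, zero_add, map_sum]
    refine VanishOrder.sum _ fun j => ?_
    rw [hw, hwb, mul_zero, add_zero, add_comm]
    exact (hφ j).mul (ih _)

theorem vanishOrder_pullback {Y : Type*} [TopologicalSpace Y] [ChartedSpace F Y]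
    [IsManifold 𝓘(ℂ, F) ω Y] [FiniteDimensional ℂ F] {f : X → Y}
    (hf : ContMDiffAt 𝓘(ℂ, E) 𝓘(ℂ, F) ω f x) {ι : Type*} (b : Module.Basis ι ℂ F) (j : ι) :
    VanishOrder 1 (pullback hf (coordGerm (f x) b j)) := by
  obtain ⟨G, hG, he⟩ := exists_ofChart (pullback hf (coordGerm (f x) b j))
  rw [he]
  refine vanishOrder_one hG ?_
  have h := (Germ.coe_eq.1 (Subtype.ext_iff.1 he)).eq_of_nhds
  simpa using h.symm

/-- The coordinate germs and partial derivatives of the preferred chart. In particular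
(`Coordinates.der_eq`) every derivation of `O_{X,x}` is an `O_{X,x}`-combination of the partial
derivatives, that is, the germ of a holomorphic vector field. -/
theorem coordinates {ι : Type*} [DecidableEq ι] [Fintype ι] (b : Module.Basis ι ℂ E) :
    Coordinates (coordGerm x b) fun i => dirDer x (b i) where
  apply_eq := dirDer_coordGerm b
  separated v hv := Derivation.ext fun p =>
    eq_zero_of_leibniz b (AlgHom.id ℂ _)
      (fun j => vanishOrder_one (analyticAt_coord b j _) (by simp)) v.toLinearMap v.map_one_eq_zero
      (fun p q => v.leibniz p q) hv p

end Model

variable [FiniteDimensional ℂ E] [FiniteDimensional ℂ F] [IsManifold 𝓘(ℂ, E) ω X]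
  [IsManifold 𝓘(ℂ, F) ω Y] {f : X → Y} {x : X}

variable (E) in
/-- The stalk `D_{X,x}` of the sheaf of holomorphic differential operators: the operators on
`O_{X,x}` generated by the germs of holomorphic functions and of holomorphic vector fields. -/
abbrev DiffOpGerms (x : X) : Subalgebra ℂ (Module.End ℂ (holGerms E x)) :=
  diffOps ℂ (holGerms E x)

/-- `O_{X,x}` as an algebra over `O_{Y,f(x)}`, by pullback. -/
abbrev pullbackAlgebra (hf : ContMDiffAt 𝓘(ℂ, E) 𝓘(ℂ, F) ω f x) :
    Algebra (holGerms F (f x)) (holGerms E x) :=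
  (pullback hf).toRingHom.toAlgebra

theorem pullback_tower (hf : ContMDiffAt 𝓘(ℂ, E) 𝓘(ℂ, F) ω f x) :
    letI := pullbackAlgebra hf
    IsScalarTower ℂ (holGerms F (f x)) (holGerms E x) :=
  letI := pullbackAlgebra hf
  IsScalarTower.of_algebraMap_eq' (pullback hf).comp_algebraMap.symm

theorem hasTransferAction (hf : ContMDiffAt 𝓘(ℂ, E) 𝓘(ℂ, F) ω f x) :
    letI := pullbackAlgebra hf
    haveI := pullback_tower hf
    HasTransferAction ℂ (holGerms F (f x)) (holGerms E x) := by
  let := pullbackAlgebra hf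
  have := pullback_tower hf
  refine (coordinates (Module.finBasis ℂ F)).hasTransferAction fun w hw => ?_
  refine Derivation.ext fun p => ?_
  exact eq_zero_of_leibniz (Module.finBasis ℂ F) (pullback hf) (vanishOrder_pullback hf _)
    w.toLinearMap w.map_one_eq_zero (fun p q => w.leibniz p q) hw p

/-- The stalk at `x` of the transfer module: `D_{X→Y,x} = O_{X,x} ⊗_{O_{Y,f(x)}} D_{Y,f(x)}`. -/
def TransferModule (hf : ContMDiffAt 𝓘(ℂ, E) 𝓘(ℂ, F) ω f x) : Type _ :=
  letI := pullbackAlgebra hf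
  holGerms E x ⊗[holGerms F (f x)] DiffOpGerms F (f x)

instance TransferModule.instAddCommGroup (hf : ContMDiffAt 𝓘(ℂ, E) 𝓘(ℂ, F) ω f x) :
    AddCommGroup (TransferModule hf) :=
  letI := pullbackAlgebra hf
  TensorProduct.addCommGroup (R := holGerms F (f x)) (M := holGerms E x)
    (N := DiffOpGerms F (f x))

/-- The left `D_{X,x}`-module structure of `D_{X→Y,x}`; see `HasTransferAction.act_ofFun` and
`HasTransferAction.act_ofDer` for its action on `b ⊗ Q`. -/
instance TransferModule.instModule (hf : ContMDiffAt 𝓘(ℂ, E) 𝓘(ℂ, F) ω f x) :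
    Module (DiffOpGerms E x) (TransferModule hf) :=
  @HasTransferAction.module ℂ (holGerms F (f x)) (holGerms E x) _ _ _ _ _ (pullbackAlgebra hf)
    (pullback_tower hf) (hasTransferAction hf)

end Germs

section FlatDimension

universe u v

open MulOpposite

variable (R : Type u) [Ring R]

/-- The relations `(n r) ⊗ m = n ⊗ (r m)`. -/
def balancedRel (N : Type*) [AddCommGroup N] [Module Rᵐᵒᵖ N] (M : Type*) [AddCommGroup M]
    [Module R M] : AddSubgroup (N ⊗[ℤ] M) :=
  AddSubgroup.closure
    {t | ∃ (n : N) (r : R) (m : M), t = (op r • n) ⊗ₜ[ℤ] m - n ⊗ₜ[ℤ] (r • m)}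

/-- The tensor product `N ⊗_R M` of a right module and a left module over a ring `R` that need not
be commutative. -/
abbrev RingTensor (N : Type*) [AddCommGroup N] [Module Rᵐᵒᵖ N] (M : Type*) [AddCommGroup M]
    [Module R M] : Type _ :=
  (N ⊗[ℤ] M) ⧸ balancedRel R N M

/-- `g ⊗ id : N ⊗_R M → N' ⊗_R M`. -/
def RingTensor.map {N N' : Type*} [AddCommGroup N] [Module Rᵐᵒᵖ N] [AddCommGroup N']
    [Module Rᵐᵒᵖ N'] (g : N →ₗ[Rᵐᵒᵖ] N') (M : Type*) [AddCommGroup M] [Module R M] :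
    RingTensor R N M →+ RingTensor R N' M :=
  QuotientAddGroup.map _ _ (LinearMap.rTensor M g.toAddMonoidHom.toIntLinearMap).toAddMonoidHom <| by
    rw [balancedRel, AddSubgroup.closure_le]
    rintro _ ⟨n, r, m, rfl⟩
    refine AddSubgroup.subset_closure ⟨g n, r, m, ?_⟩
    simp

/-- A left `R`-module `M` is flat if `- ⊗_R M` preserves injections of right `R`-modules. (It is
enough to test right modules in the universe of `R`.) -/
def IsFlat (M : Type v) [AddCommGroup M] [Module R M] : Prop :=
  ∀ (N N' : Type u) [AddCommGroup N] [AddCommGroup N'] [Module Rᵐᵒᵖ N] [Module Rᵐᵒᵖ N']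
    (g : N →ₗ[Rᵐᵒᵖ] N'), Function.Injective g → Function.Injective (RingTensor.map R g M)

/-- A flat resolution `0 → obj n → ⋯ → obj 1 → obj 0 → M → 0` of length at most `n`. -/
structure FlatResolution (M : Type v) [AddCommGroup M] [Module R M] (n : ℕ) where
  obj : ℕ → Type (max u v)
  [addCommGroup : ∀ i, AddCommGroup (obj i)]
  [module : ∀ i, Module R (obj i)]
  d : ∀ i, obj (i + 1) →ₗ[R] obj i
  aug : obj 0 →ₗ[R] M
  flat : ∀ i, IsFlat R (obj i)
  aug_surjective : Function.Surjective aug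
  exact_zero : Function.Exact (d 0) aug
  exact_succ : ∀ i, Function.Exact (d (i + 1)) (d i)
  length_le : ∀ i, n < i → Subsingleton (obj i)

/-- The flat dimension of `M`: the least length of a flat resolution, `⊤` if there is none. -/
noncomputable def flatDim (M : Type v) [AddCommGroup M] [Module R M] : ℕ∞ :=
  ⨅ (n : ℕ) (_ : Nonempty (FlatResolution R M n)), (n : ℕ∞)

end FlatDimension

/-- The complex rank of `df(x) : T_x X → T_{f(x)} Y`. -/
noncomputable def rankAt {E : Type*} [NormedAddCommGroup E] [NormedSpace ℂ E]
    {F : Type*} [NormedAddCommGroup F] [NormedSpace ℂ F]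
    {X : Type*} [TopologicalSpace X] [ChartedSpace E X]
    {Y : Type*} [TopologicalSpace Y] [ChartedSpace F Y] (f : X → Y) (x : X) : ℕ :=
  Module.finrank ℂ (LinearMap.range (mfderiv 𝓘(ℂ, E) 𝓘(ℂ, F) f x).toLinearMap)

end DiffOp

/-!
Write `O` and `D` for the stalks at `x₀` of the sheaves of functions and of differential operators on
`X`. For functions `g_s ∈ O`, `s ∈ σ`, let `D` act on the polynomials `O[η_s : s ∈ σ]` by
`v • (b η^β) = v(b) η^β + ∑_s b v(g_s) η_s η^β` for vector fields `v`, and by multiplication for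
functions. This is the module `PolyTransfer g`, the transfer module of the map to affine space with
components `g`; it is well defined because it acts on `O ⊗ D(ℂ[y_s : s ∈ σ])`. In local coordinates
`y_j` of `Y` at `f(x₀)`, the transfer module of `f` is `PolyTransfer` of the germs `y_j ∘ f`, with
`η^β` in the place of `1 ⊗ ∂^β` (`Coordinates.nonempty_equiv_polyTransfer`).

Two facts about these modules give the bound.

* If one more function is added to `g`, with variable `η₀`, then multiplication by `η₀` is injective
  and `D`-linear, with cokernel `PolyTransfer g`. So removing a function raises the projective
  dimension by at most one (`PolyTransfer.hasProjectiveDimensionLT_succ`).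
* If `g` consists of coordinates `x_i` of `X` and of further functions `f_j`, then `PolyTransfer g` is
  free, with basis the monomials in the variables of the `f_j`: the operator `∂^α` takes such a
  monomial `η^β` to `η^α η^β` plus terms of lower degree in the variables of the `x_i`
  (`PolyTransfer.polyHom_smul_mon`, `PolyTransfer.projective_of_coordinates`).

Let `r` be the rank of `df(x₀)`, and `n` the dimension of `X`. In bases adapted to `df(x₀)`, the first
`r` components of `f` together with the last `n - r` coordinates of `X` have an invertible Jacobian
matrix at `x₀`, so they are coordinates (`Coordinates.exists_of_isUnit_det`). Adding these `n - r`
coordinates to the components of `f` therefore gives a free module, and removing them again gives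
projective dimension at most `n - r` for the transfer module of `f`. A projective module is flat
(`isFlat_of_projective`), so there is a flat resolution of the same length.
-/

namespace DiffOp

/-! ### Flat resolutions from projective dimension -/

section FlatResolutions

open MulOpposite CategoryTheory

universe u v

variable {R : Type u} [Ring R]

theorem RingTensor.op_smul_tmul {N : Type*} [AddCommGroup N] [Module Rᵐᵒᵖ N] {M : Type*}
    [AddCommGroup M] [Module R M] (n : N) (r : R) (m : M) :
    (((op r • n) ⊗ₜ[ℤ] m : N ⊗[ℤ] M) : RingTensor R N M) =
      ((n ⊗ₜ[ℤ] (r • m) : N ⊗[ℤ] M) : RingTensor R N M) := by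
  rw [← sub_eq_zero, ← QuotientAddGroup.mk_sub, QuotientAddGroup.eq_zero_iff]
  exact AddSubgroup.subset_closure ⟨n, r, m, rfl⟩

section Coefficients

variable {M : Type*} [AddCommGroup M] [Module R M] {ι : Type*} (s : M →ₗ[R] ι →₀ R)
  (N : Type*) [AddCommGroup N] [Module Rᵐᵒᵖ N]

/-- The biadditive map `(n, r) ↦ n r` of a right module. -/
def rightMul : N →+ R →+ N :=
  AddMonoidHom.mk' (fun n => AddMonoidHom.mk' (fun r => op r • n) fun r r' => by
    rw [MulOpposite.op_add, add_smul]) fun n n' => by ext r; simp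

/-- `N ⊗_ℤ M → N^(ι)`, `n ⊗ m ↦ n · s(m)`, for a map of coordinates `s : M → R^(ι)`. -/
noncomputable def tensorCoeffInt : N ⊗[ℤ] M →+ ι →₀ N :=
  TensorProduct.liftAddHom
    (AddMonoidHom.mk' (fun n => (Finsupp.mapRange.addMonoidHom (rightMul (R := R) N n)).comp
      s.toAddMonoidHom) fun n n' => by
        ext m i; simp)
    fun z n m => by
      ext i
      change op (s m i) • (z • n) = op (s (z • m) i) • n
      rw [map_zsmul, Finsupp.smul_apply, op_smul, smul_comm, smul_assoc]

theorem tensorCoeffInt_tmul (n : N) (m : M) (i : ι) :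
    tensorCoeffInt s N (n ⊗ₜ m) i = op (s m i) • n := rfl

/-- `N ⊗_R M → N^(ι)`, `n ⊗ m ↦ n · s(m)`. -/
noncomputable def tensorCoeff : RingTensor R N M →+ ι →₀ N :=
  QuotientAddGroup.lift _ (tensorCoeffInt s N) <| by
    rw [balancedRel, AddSubgroup.closure_le]
    rintro _ ⟨n, r, m, rfl⟩
    change tensorCoeffInt s N _ = 0
    ext i
    simp [tensorCoeffInt_tmul, mul_smul]

theorem tensorCoeff_map {N N' : Type*} [AddCommGroup N] [Module Rᵐᵒᵖ N] [AddCommGroup N']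
    [Module Rᵐᵒᵖ N'] (g : N →ₗ[Rᵐᵒᵖ] N') (t : RingTensor R N M) :
    tensorCoeff s N' (RingTensor.map R g M t) =
      Finsupp.mapRange.addMonoidHom g.toAddMonoidHom (tensorCoeff s N t) := by
  obtain ⟨t, rfl⟩ := QuotientAddGroup.mk_surjective t
  induction t using TensorProduct.induction_on with
  | zero => simp
  | add a b ha hb => simp only [QuotientAddGroup.mk_add, map_add, ha, hb]
  | tmul n m =>
    ext i
    change op (s m i) • g n = g (op (s m i) • n)
    rw [map_smul]

end Coefficients

/-- If `s` is a section of `R^(M) → M`, then `N ⊗_R M` is a direct summand of `N^(M)`, naturally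
in `N`. -/
theorem isFlat_of_projective (M : Type v) [AddCommGroup M] [Module R M] [Module.Projective R M] :
    IsFlat R M := by
  obtain ⟨s, hs⟩ := Module.Projective.out (R := R) (P := M)
  have hinj : ∀ (N : Type u) [AddCommGroup N] [Module Rᵐᵒᵖ N],
      Function.Injective (tensorCoeff s N) := by
    intro N _ _
    let r : (M →₀ N) →+ RingTensor R N M := Finsupp.liftAddHom fun m =>
      (QuotientAddGroup.mk' (balancedRel R N M)).comp
        ((TensorProduct.mk ℤ N M).flip m).toAddMonoidHom
    refine Function.LeftInverse.injective (g := r) fun t => ?_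
    obtain ⟨t, rfl⟩ := QuotientAddGroup.mk_surjective t
    induction t using TensorProduct.induction_on with
    | zero => simp
    | add a b ha hb => simp only [QuotientAddGroup.mk_add, map_add, ha, hb]
    | tmul n m =>
      have h1 : r (tensorCoeff s N ((n ⊗ₜ[ℤ] m : N ⊗[ℤ] M) : RingTensor R N M)) =
          (s m).sum fun i a => (((op a • n) ⊗ₜ[ℤ] i : N ⊗[ℤ] M) : RingTensor R N M) := by
        change Finsupp.liftAddHom _ (Finsupp.mapRange (rightMul N n) (map_zero _) (s m)) = _
        rw [Finsupp.liftAddHom_apply]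
        exact (Finsupp.sum_mapRange_index (hf := map_zero (rightMul N n)) fun i => map_zero _)
      rw [h1]
      simp only [RingTensor.op_smul_tmul]
      conv_rhs => rw [← hs m, Finsupp.linearCombination_apply, Finsupp.sum, TensorProduct.tmul_sum]
      exact (map_sum (QuotientAddGroup.mk' (balancedRel R N M)) _ _).symm
  intro N N' _ _ _ _ g hg
  rw [injective_iff_map_eq_zero]
  intro t ht
  have h := tensorCoeff_map s g t
  rw [ht, map_zero] at h
  refine (injective_iff_map_eq_zero _).1 (hinj N) t ?_
  refine Finsupp.mapRange_injective g (map_zero g) hg ?_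
  rw [Finsupp.mapRange_zero]
  exact h.symm

/-- The sequence `M, 0, 0, …`. -/
def FlatResolution.zeroObj (M : Type v) : ℕ → Type v
  | 0 => M
  | _ + 1 => PUnit

theorem nonempty_flatResolution_zero (M : Type max u v) [AddCommGroup M] [Module R M]
    [Module.Projective R M] : Nonempty (FlatResolution R M 0) := by
  let grp : ∀ i, AddCommGroup (FlatResolution.zeroObj M i) := fun
    | 0 => (inferInstance : AddCommGroup M)
    | _ + 1 => (inferInstance : AddCommGroup PUnit.{max u v + 1})
  let mod : ∀ i, Module R (FlatResolution.zeroObj M i) := fun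
    | 0 => (inferInstance : Module R M)
    | _ + 1 => (inferInstance : Module R PUnit.{max u v + 1})
  exact ⟨{
    obj := FlatResolution.zeroObj M
    d := fun _ => 0
    aug := (LinearMap.id : M →ₗ[R] M)
    flat := fun
      | 0 => isFlat_of_projective M
      | _ + 1 =>
        have : Module.Projective R PUnit.{max u v + 1} :=
          Module.Projective.of_lifting_property' fun _ g _ =>
            ⟨0, LinearMap.ext fun x => by rw [Subsingleton.elim x 0, map_zero, map_zero]⟩
        isFlat_of_projective PUnit.{max u v + 1}
    aug_surjective := Function.surjective_id
    exact_zero := fun m => ⟨fun h => ⟨0, h.symm⟩, by rintro ⟨_, rfl⟩; rfl⟩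
    exact_succ := fun i p => ⟨fun _ => ⟨0, rfl⟩, fun _ => rfl⟩
    length_le := fun
      | 0, h => absurd h (lt_irrefl 0)
      | _ + 1, _ => inferInstanceAs (Subsingleton PUnit) }⟩

/-- The sequence `P, obj 0, obj 1, …`. -/
def FlatResolution.consObj (P : Type v) (obj : ℕ → Type v) : ℕ → Type v
  | 0 => P
  | i + 1 => obj i

theorem FlatResolution.cons {M P : Type max u v} [AddCommGroup M] [Module R M] [AddCommGroup P]
    [Module R P] (hP : IsFlat R P) (p : P →ₗ[R] M) (hp : Function.Surjective p) {n : ℕ}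
    (K : FlatResolution R (LinearMap.ker p) n) : Nonempty (FlatResolution R M (n + 1)) := by
  let _ := K.addCommGroup
  let _ := K.module
  let grp : ∀ i, AddCommGroup (FlatResolution.consObj P K.obj i) := fun
    | 0 => (inferInstance : AddCommGroup P)
    | i + 1 => K.addCommGroup i
  let mod : ∀ i, Module R (FlatResolution.consObj P K.obj i) := fun
    | 0 => (inferInstance : Module R P)
    | i + 1 => K.module i
  let d : ∀ i, FlatResolution.consObj P K.obj (i + 1) →ₗ[R] FlatResolution.consObj P K.obj i := fun
    | 0 => (LinearMap.ker p).subtype ∘ₗ K.aug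
    | i + 1 => K.d i
  exact ⟨{
    obj := FlatResolution.consObj P K.obj
    d := d
    aug := p
    flat := fun
      | 0 => hP
      | i + 1 => K.flat i
    aug_surjective := hp
    exact_zero := fun x => by
      refine ⟨fun h => ?_, ?_⟩
      · obtain ⟨y, hy⟩ := K.aug_surjective ⟨x, h⟩
        exact ⟨y, congrArg Subtype.val hy⟩
      · rintro ⟨y, rfl⟩
        exact (K.aug y).2
    exact_succ := fun
      | 0 => fun x => by
        refine Iff.trans ?_ (K.exact_zero x)
        exact (Subtype.ext_iff (a1 := K.aug x) (a2 := 0)).symm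
      | i + 1 => K.exact_succ i
    length_le := fun
      | 0, h => absurd h (Nat.not_lt_zero _)
      | i + 1, h => K.length_le i (Nat.lt_of_succ_lt_succ h) }⟩

/-- The kernel of a free cover has projective dimension one less, so free covers of the successive
kernels form a resolution whose last kernel is projective. -/
theorem nonempty_flatResolution (n : ℕ) (M : Type max u v) [AddCommGroup M] [Module R M]
    (h : HasProjectiveDimensionLT (ModuleCat.of R M) (n + 1)) :
    Nonempty (FlatResolution R M n) := by
  induction n generalizing M with
  | zero =>
    have : Projective (ModuleCat.of R M) := inferInstance
    have : Module.Projective R M :=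
      (IsProjective.iff_projective M).2 this
    exact nonempty_flatResolution_zero M
  | succ n ih =>
    have hp : Function.Surjective (Finsupp.linearCombination R (id : M → M)) :=
      Finsupp.linearCombination_id_surjective R M
    have hS := LinearMap.shortExact_shortComplexKer hp
    have hK := hS.hasProjectiveDimensionLT_X₁ (n + 1)
      (inferInstanceAs (HasProjectiveDimensionLT (ModuleCat.of R (M →₀ R)) (n + 1))) h
    obtain ⟨K⟩ := ih (LinearMap.ker (Finsupp.linearCombination R (id : M → M))) hK
    exact FlatResolution.cons (isFlat_of_projective _) _ hp K

theorem flatDim_le (n : ℕ) (M : Type max u v) [AddCommGroup M] [Module R M]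
    (h : HasProjectiveDimensionLT (ModuleCat.of R M) (n + 1)) : flatDim R M ≤ n :=
  iInf₂_le n (nonempty_flatResolution n M h)

end FlatResolutions

/-! ### Polynomial models of transfer modules -/

section Model

variable {k A B : Type*} [Field k] [CommRing A] [CommRing B] [Algebra k A] [Algebra k B]

/-- The operators of order at most one generate the differential operators, so that linearity may be
tested on them. -/
theorem map_diffOps_smul {N N' : Type*} [AddCommGroup N] [AddCommGroup N'] [Module (diffOps k B) N]
    [Module (diffOps k B) N'] (θ : N →+ N')
    (hfun : ∀ (b : B) (t : N), θ (ofFun k B b • t) = ofFun k B b • θ t)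
    (hder : ∀ (v : Derivation k B B) (t : N), θ (ofDer k B v • t) = ofDer k B v • θ t)
    (P : diffOps k B) (t : N) : θ (P • t) = P • θ t := by
  obtain ⟨P, hP⟩ := P
  induction hP using Algebra.adjoin_induction generalizing t with
  | mem x hx =>
    rcases hx with ⟨b, rfl⟩ | ⟨v, rfl⟩
    · exact hfun b t
    · exact hder v t
  | algebraMap r =>
    have : (⟨algebraMap k _ r, Subalgebra.algebraMap_mem _ r⟩ : diffOps k B) =
        ofFun k B (algebraMap k B r) := ((ofFun k B).commutes r).symm
    rw [this, hfun]
  | add x z hx hz ihx ihz =>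
    have : (⟨x + z, add_mem hx hz⟩ : diffOps k B) = ⟨x, hx⟩ + ⟨z, hz⟩ := rfl
    rw [this, add_smul, map_add, ihx, ihz, add_smul]
  | mul x z hx hz ihx ihz =>
    have : (⟨x * z, mul_mem hx hz⟩ : diffOps k B) = ⟨x, hx⟩ * ⟨z, hz⟩ := rfl
    rw [this, mul_smul, ihx, ihz, mul_smul]

section Normal

variable [Algebra A B] [IsScalarTower k A B] {ι : Type*} [DecidableEq ι] {y : ι → A}
  {d : ι → Derivation k A A}

/-- The chain rule `v (φ g) = ∑ v (φ y_j) φ (∂g/∂y_j)`, where `φ` is the structure map. -/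
theorem Coordinates.chain_rule [Fintype ι] (h : Coordinates y d)
    (hB : ∀ w : Derivation k A B, (∀ j, w (y j) = 0) → w = 0) (v : Derivation k B B) (g : A) :
    v (algebraMap A B g) = ∑ j, v (algebraMap A B (y j)) * algebraMap A B (d j g) := by
  let w : Derivation k A B := v.compAlgebraMap A -
    ∑ j, v (algebraMap A B (y j)) • (Algebra.linearMap A B).compDer (d j)
  have hw : ∀ g, w g = v (algebraMap A B g) -
      ∑ j, v (algebraMap A B (y j)) * algebraMap A B (d j g) := by
    intro g
    simp only [w, Derivation.sub_apply, ← Derivation.coeFnAddMonoidHom_apply, map_sum,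
      Finset.sum_apply]
    rfl
  have h0 : w = 0 := hB w fun j => by
    rw [hw]
    simp [h.apply_eq, apply_ite]
  have := hw g
  rw [h0] at this
  exact sub_eq_zero.1 this.symm

/-- The normal form `∑ b_β ⊗ ∂^β` of an element of `B ⊗_A D(A)` is unique: its lowest coefficients
are found by evaluation on monomials. -/
theorem eq_zero_of_sum_tmul_eq_zero [CharZero k]
    (hy : ∀ i j, d i (y j) = if i = j then 1 else 0) (Φ : MvPolynomial ι k →ₐ[k] diffOps k A)
    (hΦ : ∀ j, Φ (MvPolynomial.X j) = ofDer k A (d j)) (c : (ι →₀ ℕ) →₀ B)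
    (hc : (c.sum fun β b => b ⊗ₜ[A] Φ (MvPolynomial.monomial β 1)) = 0) : c = 0 := by
  by_contra hne
  obtain ⟨γ, hγ⟩ := c.support.exists_minimal
    (Finset.nonempty_iff_ne_empty.2 fun h0 => hne (Finsupp.support_eq_empty.1 h0))
  have he := LinearMap.congr_fun ((congrArg (ev k A B) hc).trans (map_zero _))
    (MvPolynomial.aeval y (MvPolynomial.monomial γ (1 : k)))
  obtain ⟨r, hr, hr'⟩ := (polyHom_apply hy Φ hΦ γ γ).2 rfl
  rw [Finsupp.sum, map_sum, LinearMap.sum_apply, Finset.sum_eq_single γ] at he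
  · rw [ev_tmul, hr', ← IsScalarTower.algebraMap_apply, mul_comm, ← Algebra.smul_def] at he
    exact Finsupp.mem_support_iff.1 hγ.prop ((smul_eq_zero_iff_right hr).1 he)
  · intro β hβ hne
    rw [ev_tmul, (polyHom_apply hy Φ hΦ β γ).1, map_zero, mul_zero]
    exact fun hle => hne (le_antisymm hle (hγ.le_of_le hβ hle))
  · exact fun hn => absurd hγ.prop hn

/-- In coordinates, `B ⊗_A D(A)` consists of polynomials `∑ b_β η^β`, where `η^β = 1 ⊗ ∂^β`. -/
theorem Coordinates.exists_transferEquiv [CharZero k] [Fintype ι] (h : Coordinates y d)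
    (hB : ∀ w : Derivation k A B, (∀ j, w (y j) = 0) → w = 0) (hT : HasTransferAction k A B) :
    ∃ e : ((ι →₀ ℕ) →₀ B) ≃+ B ⊗[A] diffOps k A,
      (∀ β b c, hT.act (ofFun k B b) (e (Finsupp.single β c)) = e (Finsupp.single β (b * c))) ∧
      ∀ β v c, hT.act (ofDer k B v) (e (Finsupp.single β c)) = e (Finsupp.single β (v c)) +
        ∑ j, e (Finsupp.single (β + Finsupp.single j 1) (c * v (algebraMap A B (y j)))) := by
  obtain ⟨Φ, hΦ⟩ := exists_polyHom (k := k) (fun j => ofDer k A (d j)) h.commute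
  let e₀ : ((ι →₀ ℕ) →₀ B) →+ B ⊗[A] diffOps k A := Finsupp.liftAddHom fun β =>
    ((TensorProduct.mk A B (diffOps k A)).flip (Φ (MvPolynomial.monomial β 1))).toAddMonoidHom
  have he₀ : ∀ c, e₀ c = c.sum fun β b => b ⊗ₜ[A] Φ (MvPolynomial.monomial β 1) := fun c => rfl
  have hs : ∀ β b, e₀ (Finsupp.single β b) = b ⊗ₜ[A] Φ (MvPolynomial.monomial β 1) := by
    intro β b
    rw [he₀, Finsupp.sum_single_index]
    exact TensorProduct.zero_tmul _ _
  have hbij : Function.Bijective e₀ := by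
    refine ⟨(injective_iff_map_eq_zero _).2 fun c hc => ?_, fun t => ?_⟩
    · exact eq_zero_of_sum_tmul_eq_zero h.apply_eq Φ hΦ c hc
    · obtain ⟨c, hc⟩ := h.exists_sum Φ hΦ t
      exact ⟨c, hc.symm⟩
  refine ⟨AddEquiv.ofBijective e₀ hbij, fun β b c => ?_, fun β v c => ?_⟩
  · change hT.act _ (e₀ _) = e₀ _
    rw [hs, hs, hT.act_ofFun]
  · change hT.act _ (e₀ _) = e₀ _ + ∑ j, e₀ _
    rw [hs, hs,
      hT.act_ofDer Finset.univ v (fun j => v (algebraMap A B (y j))) d (h.chain_rule hB v)]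
    congr 1
    refine Finset.sum_congr rfl fun j _ => ?_
    rw [hs, ← hΦ, ← map_mul, MvPolynomial.X, MvPolynomial.monomial_mul, one_mul, add_comm]

end Normal

theorem coordinates_mvPolynomial {σ : Type*} [DecidableEq σ] :
    Coordinates (k := k) (fun s : σ => (MvPolynomial.X s : MvPolynomial σ k))
      fun s => MvPolynomial.pderiv s where
  apply_eq i j := by
    rw [MvPolynomial.pderiv_X, Pi.single_apply]
    simp [eq_comm]
  separated v hv := MvPolynomial.derivation_ext hv

/-- Polynomials `∑ b_β η^β` in variables indexed by `σ`: the transfer module of the map to affine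
space with components `g`, with `η_s` in the place of the partial derivative `∂/∂y_s`. A polynomial
is the finitely supported function of its coefficients. The synonym depends on `g` because the action
of differential operators does, and is not the action on coefficients. -/
def PolyTransfer {σ : Type*} (_g : σ → B) : Type _ := (σ →₀ ℕ) →₀ B

noncomputable instance {σ : Type*} (g : σ → B) : AddCommGroup (PolyTransfer g) :=
  inferInstanceAs (AddCommGroup ((σ →₀ ℕ) →₀ B))

namespace PolyTransfer

variable {σ : Type*}

/-- The monomial `b η^β`. -/
noncomputable def mon (g : σ → B) (β : σ →₀ ℕ) : B →+ PolyTransfer g := Finsupp.singleAddHom β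

/-- The coefficient of `η^β`. -/
def coeff {g : σ → B} (β : σ →₀ ℕ) : PolyTransfer g →+ B := Finsupp.applyAddHom β

theorem coeff_mon_self {g : σ → B} (β : σ →₀ ℕ) (b : B) : coeff β (mon g β b) = b :=
  Finsupp.single_eq_same

theorem coeff_mon_of_ne {g : σ → B} {β γ : σ →₀ ℕ} (h : β ≠ γ) (b : B) :
    coeff γ (mon g β b) = 0 :=
  Finsupp.single_eq_of_ne h.symm

theorem induction {g : σ → B} {p : PolyTransfer g → Prop} (t : PolyTransfer g) (h0 : p 0)
    (hadd : ∀ s t, p s → p t → p (s + t)) (hmon : ∀ β b, p (mon g β b)) : p t :=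
  Finsupp.induction_linear t h0 hadd hmon

/-- The action on `B ⊗ D(k[σ])`, where `k[σ] → B` takes the variables to `g`, in the normal form
`∑ b_β ⊗ ∂^β`. -/
theorem exists_module (k : Type*) [Field k] [CharZero k] [Algebra k B] [Fintype σ] (g : σ → B) :
    ∃ _ : Module (diffOps k B) (PolyTransfer g),
      (∀ β (b c : B), ofFun k B b • mon g β c = mon g β (b * c)) ∧
      ∀ β (v : Derivation k B B) (c : B), ofDer k B v • mon g β c =
        mon g β (v c) + ∑ j, mon g (β + Finsupp.single j 1) (c * v (g j)) := by
  classical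
  let _ : Algebra (MvPolynomial σ k) B := (MvPolynomial.aeval g).toRingHom.toAlgebra
  have _ : IsScalarTower k (MvPolynomial σ k) B :=
    IsScalarTower.of_algebraMap_eq' (MvPolynomial.aeval (R := k) g).comp_algebraMap.symm
  have hB : ∀ w : Derivation k (MvPolynomial σ k) B, (∀ j, w (MvPolynomial.X j) = 0) → w = 0 :=
    fun w hw => MvPolynomial.derivation_ext hw
  have hT := (coordinates_mvPolynomial (k := k) (σ := σ)).hasTransferAction hB
  obtain ⟨e₀, h1, h2⟩ := (coordinates_mvPolynomial (k := k) (σ := σ)).exists_transferEquiv hB hT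
  let e : PolyTransfer g ≃+ B ⊗[MvPolynomial σ k] diffOps k (MvPolynomial σ k) := e₀
  have hX : ∀ j, algebraMap (MvPolynomial σ k) B (MvPolynomial.X j) = g j :=
    fun j => MvPolynomial.aeval_X g j
  let _ := hT.module
  refine ⟨e.module (diffOps k B), fun β b c => ?_, fun β v c => ?_⟩
  · exact e.symm_apply_eq.2 (h1 β b c)
  · refine e.symm_apply_eq.2 ((h2 β v c).trans ?_)
    simp only [hX]
    rw [e.map_add]
    exact congrArg _ (map_sum e.toAddMonoidHom _ _).symm

variable [CharZero k]

/-- Vector fields act by the Leibniz and chain rules, see `PolyTransfer.ofDer_smul_mon`. -/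
noncomputable instance [Fintype σ] (g : σ → B) : Module (diffOps k B) (PolyTransfer g) :=
  (exists_module k g).choose

variable [Fintype σ]

theorem ofFun_smul_mon (g : σ → B) (β : σ →₀ ℕ) (b c : B) :
    ofFun k B b • mon g β c = mon g β (b * c) :=
  (exists_module k g).choose_spec.1 β b c

theorem ofDer_smul_mon (g : σ → B) (β : σ →₀ ℕ) (v : Derivation k B B) (c : B) :
    ofDer k B v • mon g β c =
      mon g β (v c) + ∑ j, mon g (β + Finsupp.single j 1) (c * v (g j)) :=
  (exists_module k g).choose_spec.2 β v c

/-- Linearity of an additive map may be tested on functions, vector fields, and monomials. -/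
noncomputable def mkLinear {g : σ → B} {N : Type*} [AddCommGroup N] [Module (diffOps k B) N]
    (θ : PolyTransfer g →+ N)
    (hfun : ∀ β (b c : B), θ (mon g β (b * c)) = ofFun k B b • θ (mon g β c))
    (hder : ∀ β (v : Derivation k B B) (c : B), θ (mon g β (v c)) +
      ∑ j, θ (mon g (β + Finsupp.single j 1) (c * v (g j))) = ofDer k B v • θ (mon g β c)) :
    PolyTransfer g →ₗ[diffOps k B] N where
  toFun := θ
  map_add' := θ.map_add
  map_smul' := by
    refine map_diffOps_smul θ (fun b t => ?_) fun v t => ?_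
    · induction t using induction with
      | h0 => simp
      | hadd s t hs ht => rw [smul_add, map_add, hs, ht, map_add, smul_add]
      | hmon β c => rw [ofFun_smul_mon, hfun]
    · induction t using induction with
      | h0 => simp
      | hadd s t hs ht => rw [smul_add, map_add, hs, ht, map_add, smul_add]
      | hmon β c => rw [ofDer_smul_mon, map_add, map_sum, hder]

/-- Renaming of the variables. -/
noncomputable def reindex {τ : Type*} [Fintype τ] (e : σ ≃ τ) {g : σ → B} {h : τ → B}
    (hgh : ∀ s, h (e s) = g s) : PolyTransfer g ≃ₗ[diffOps k B] PolyTransfer h :=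
  let E : PolyTransfer g ≃+ PolyTransfer h :=
    (Finsupp.domCongr (Finsupp.domCongr (M := ℕ) e).toEquiv : ((σ →₀ ℕ) →₀ B) ≃+ ((τ →₀ ℕ) →₀ B))
  have hE : ∀ β b, E (mon g β b) = mon h (Finsupp.domCongr e β) b := fun β b =>
    Finsupp.equivMapDomain_single _ _ _
  LinearEquiv.ofBijective (mkLinear E.toAddMonoidHom
    (fun β b c => by
      simp only [AddEquiv.toAddMonoidHom_eq_coe, AddMonoidHom.coe_coe, hE, ofFun_smul_mon])
    (fun β v c => by
      simp only [AddEquiv.toAddMonoidHom_eq_coe, AddMonoidHom.coe_coe, hE, ofDer_smul_mon, map_add]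
      congr 1
      rw [← e.sum_comp]
      refine Finset.sum_congr rfl fun s _ => ?_
      rw [hgh]
      congr 2
      simp)) E.bijective

end PolyTransfer

/-- The transfer module `B ⊗_A D(A)` only depends on the images in `B` of coordinates of `A`. -/
theorem Coordinates.nonempty_equiv_polyTransfer [CharZero k] [Algebra A B] [IsScalarTower k A B] {ι : Type*}
    [DecidableEq ι] [Fintype ι] {y : ι → A} {d : ι → Derivation k A A} (h : Coordinates y d)
    (hB : ∀ w : Derivation k A B, (∀ j, w (y j) = 0) → w = 0) (hT : HasTransferAction k A B) :
    letI := hT.module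
    Nonempty (PolyTransfer (fun j => algebraMap A B (y j)) ≃ₗ[diffOps k B]
      B ⊗[A] diffOps k A) := by
  let := hT.module
  obtain ⟨e, h1, h2⟩ := h.exists_transferEquiv hB hT
  let θ : PolyTransfer (fun j => algebraMap A B (y j)) →+ B ⊗[A] diffOps k A := e.toAddMonoidHom
  exact ⟨LinearEquiv.ofBijective (PolyTransfer.mkLinear (k := k) θ (fun β b c => (h1 β b c).symm)
    fun β v c => (h2 β v c).symm) e.bijective⟩

end Model

/-! ### Adding a component to a map -/

namespace PolyTransfer

open CategoryTheory

universe u w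

variable {k : Type*} {B : Type u} [Field k] [CharZero k] [CommRing B] [Algebra k B] {σ : Type w}
  [Fintype σ]

/-- Multiplication by the variable `η_s`, as a homomorphism of groups. -/
noncomputable def mulVarHom (g : σ → B) (s : σ) : PolyTransfer g →+ PolyTransfer g :=
  (Finsupp.mapDomain.addMonoidHom (· + Finsupp.single s 1) :
    ((σ →₀ ℕ) →₀ B) →+ ((σ →₀ ℕ) →₀ B))

omit [Fintype σ] in
theorem mulVarHom_mon (g : σ → B) (s : σ) (β : σ →₀ ℕ) (b : B) :
    mulVarHom g s (mon g β b) = mon g (β + Finsupp.single s 1) b :=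
  Finsupp.mapDomain_single

variable (k) in
/-- Multiplication by the variable `η_s`. -/
noncomputable def mulVar (g : σ → B) (s : σ) : PolyTransfer g →ₗ[diffOps k B] PolyTransfer g :=
  mkLinear (mulVarHom g s)
    (fun β b c => by rw [mulVarHom_mon, mulVarHom_mon, ofFun_smul_mon])
    (fun β v c => by
      simp only [mulVarHom_mon]
      rw [ofDer_smul_mon]
      congr 1
      exact Finset.sum_congr rfl fun j _ => by rw [add_right_comm])

theorem mulVar_mon (g : σ → B) (s : σ) (β : σ →₀ ℕ) (b : B) :
    mulVar k g s (mon g β b) = mon g (β + Finsupp.single s 1) b :=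
  mulVarHom_mon g s β b

theorem mulVar_injective (g : σ → B) (s : σ) : Function.Injective (mulVar k g s) :=
  Finsupp.mapDomain_injective fun _ _ h => add_right_cancel h

variable {g : σ → B} {h : Option σ → B}

/-- Setting the additional variable equal to zero, as a homomorphism of groups. -/
noncomputable def killHom (g : σ → B) (h : Option σ → B) : PolyTransfer h →+ PolyTransfer g :=
  (Finsupp.liftAddHom fun γ => if γ none = 0 then mon g γ.some else 0 :
    ((Option σ →₀ ℕ) →₀ B) →+ PolyTransfer g)

omit [Fintype σ] in
theorem killHom_mon (γ : Option σ →₀ ℕ) (b : B) :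
    killHom g h (mon h γ b) = if γ none = 0 then mon g γ.some b else 0 := by
  refine (Finsupp.liftAddHom_apply_single _ _ _).trans ?_
  split_ifs <;> rfl

variable (k) in
/-- Setting the additional variable equal to zero. -/
noncomputable def kill (hgh : ∀ s, h (some s) = g s) :
    PolyTransfer h →ₗ[diffOps k B] PolyTransfer g :=
  mkLinear (killHom g h)
    (fun γ b c => by
      rw [killHom_mon, killHom_mon]
      split_ifs
      · rw [ofFun_smul_mon]
      · rw [smul_zero])
    (fun γ v c => by
      simp only [killHom_mon, Fintype.sum_option, Finsupp.add_apply]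
      by_cases h0 : γ none = 0
      · rw [if_pos h0, if_pos h0, ofDer_smul_mon]
        simp [h0, hgh, Finsupp.some_add]
      · simp [h0])

theorem kill_mon (hgh : ∀ s, h (some s) = g s) (γ : Option σ →₀ ℕ) (b : B) :
    kill k hgh (mon h γ b) = if γ none = 0 then mon g γ.some b else 0 :=
  killHom_mon γ b

theorem kill_mulVar (hgh : ∀ s, h (some s) = g s) (p : PolyTransfer h) :
    kill k hgh (mulVar k h none p) = 0 := by
  induction p using induction with
  | h0 => simp
  | hadd p q hp hq => rw [map_add, map_add, hp, hq, add_zero]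
  | hmon γ b => simp [mulVar_mon, kill_mon]

omit [Fintype σ] in
theorem embDomain_some_of_none {γ : Option σ →₀ ℕ} (h0 : γ none = 0) :
    Finsupp.embDomain Function.Embedding.some γ.some = γ := by
  ext o
  cases o with
  | none => rw [h0, Finsupp.embDomain_some_none]
  | some s => rw [Finsupp.embDomain_some_some, Finsupp.some_apply]

theorem kill_mon_embDomain (hgh : ∀ s, h (some s) = g s) (β : σ →₀ ℕ) (b : B) :
    kill k hgh (mon h (Finsupp.embDomain Function.Embedding.some β) b) = mon g β b := by
  rw [kill_mon, if_pos (Finsupp.embDomain_some_none β)]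
  congr 2
  ext s
  rw [Finsupp.some_apply, Finsupp.embDomain_some_some]

theorem kill_surjective (hgh : ∀ s, h (some s) = g s) : Function.Surjective (kill k hgh) := by
  intro p
  induction p using induction with
  | h0 => exact ⟨0, map_zero _⟩
  | hadd p q hp hq =>
    obtain ⟨p', rfl⟩ := hp
    obtain ⟨q', rfl⟩ := hq
    exact ⟨p' + q', map_add _ _ _⟩
  | hmon β b => exact ⟨_, kill_mon_embDomain hgh β b⟩

/-- A polynomial is a multiple of the additional variable plus its part free of that variable. The
additive map `i`, which regards a polynomial as one in an additional variable, is not linear. -/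
theorem exists_eq_mulVar_add (hgh : ∀ s, h (some s) = g s) :
    ∃ i : PolyTransfer g →+ PolyTransfer h, ∀ p, ∃ q, p = mulVar k h none q + i (kill k hgh p) := by
  let i : PolyTransfer g →+ PolyTransfer h := (Finsupp.liftAddHom fun β =>
    mon h (Finsupp.embDomain Function.Embedding.some β) : ((σ →₀ ℕ) →₀ B) →+ PolyTransfer h)
  refine ⟨i, fun p => ?_⟩
  induction p using induction with
  | h0 => exact ⟨0, by simp⟩
  | hadd p q hp hq =>
    obtain ⟨p', hp⟩ := hp
    obtain ⟨q', hq⟩ := hq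
    refine ⟨p' + q', ?_⟩
    rw [map_add, map_add, map_add, add_add_add_comm, ← hp, ← hq]
  | hmon γ b =>
    by_cases h0 : γ none = 0
    · refine ⟨0, ?_⟩
      rw [kill_mon, if_pos h0, map_zero, zero_add]
      refine Eq.trans ?_ (Finsupp.liftAddHom_apply_single _ _ _).symm
      rw [embDomain_some_of_none h0]
    · refine ⟨mon h (γ - Finsupp.single none 1) b, ?_⟩
      rw [kill_mon, if_neg h0, map_zero, add_zero, mulVar_mon, tsub_add_cancel_of_le]
      rw [Finsupp.single_le_iff]
      exact Nat.one_le_iff_ne_zero.2 h0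

theorem exact_mulVar_kill (hgh : ∀ s, h (some s) = g s) :
    Function.Exact (mulVar k h none) (kill k hgh) := by
  intro p
  refine ⟨fun hp => ?_, ?_⟩
  · obtain ⟨i, hi⟩ := exists_eq_mulVar_add (k := k) hgh
    obtain ⟨q, hq⟩ := hi p
    rw [hp, map_zero, add_zero] at hq
    exact ⟨q, hq.symm⟩
  · rintro ⟨q, rfl⟩
    exact kill_mulVar hgh q

/-- By the exact sequence `0 → B[η, η₀] → B[η, η₀] → B[η] → 0`, removal of a component increases the
projective dimension by at most one. -/
theorem hasProjectiveDimensionLT_succ (hgh : ∀ s, h (some s) = g s) (n : ℕ)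
    (hn : HasProjectiveDimensionLT (ModuleCat.of (diffOps k B) (PolyTransfer h)) n) :
    HasProjectiveDimensionLT (ModuleCat.of (diffOps k B) (PolyTransfer g)) (n + 1) :=
  (ModuleCat.shortComplex_shortExact
    (ModuleCat.shortComplexOfCompEqZero (mulVar k h none) (kill k hgh)
      (LinearMap.ext (kill_mulVar hgh)))
    (exact_mulVar_kill hgh) (mulVar_injective h none)
    (kill_surjective hgh)).hasProjectiveDimensionLT_X₃ n hn
    (hasProjectiveDimensionLT_of_ge _ n (n + 1) n.le_succ)

/-- The equivalence `Option σ ⊕ Fin n ≃ σ ⊕ Fin (n + 1)`. -/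
def optionSumFin (σ : Type*) (n : ℕ) : Option σ ⊕ Fin n ≃ σ ⊕ Fin (n + 1) :=
  (Equiv.sumCongr (Equiv.optionEquivSumPUnit.{0} σ) (Equiv.refl _)).trans <|
    (Equiv.sumAssoc _ _ _).trans <| Equiv.sumCongr (Equiv.refl σ) <|
      (Equiv.sumComm _ _).trans <| (Equiv.optionEquivSumPUnit.{0} _).symm.trans
        (finSuccEquiv n).symm

/-- If `g` becomes immersive, in the sense that the transfer module is projective, after adding `n`
components, then its transfer module has projective dimension at most `n`. -/
theorem hasProjectiveDimensionLT_of_projective (n : ℕ) {σ : Type w} [Fintype σ] (g : σ → B)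
    (x : Fin n → B) (hp : Module.Projective (diffOps k B) (PolyTransfer (Sum.elim g x))) :
    HasProjectiveDimensionLT (ModuleCat.of (diffOps k B) (PolyTransfer g)) (n + 1) := by
  induction n generalizing σ with
  | zero =>
    have := Module.Projective.of_equiv (reindex (k := k) (Equiv.sumEmpty σ (Fin 0))
      (g := Sum.elim g x) (h := g) fun s => by cases s with
        | inl s => rfl
        | inr s => exact s.elim0)
    infer_instance
  | succ n ih =>
    let g' : Option σ → B := fun o => o.elim (x 0) g
    refine hasProjectiveDimensionLT_succ (h := g') (fun s => rfl) _
      (ih g' (fun i => x i.succ) ?_)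
    refine Module.Projective.of_equiv (reindex (k := k) (optionSumFin σ n)
      (g := Sum.elim g' fun i => x i.succ) (h := Sum.elim g x) fun s => ?_).symm
    rcases s with (_ | s) | i
    · simp [optionSumFin, g']
    · simp [optionSumFin, g']
    · simp [optionSumFin, g']

end PolyTransfer

/-! ### Immersions -/

section Immersion

variable {k B : Type*} [Field k] [CommRing B] [Algebra k B] {ι : Type*} [Fintype ι]
  {x : ι → B} {d : ι → Derivation k B B}

/-- The case of the identity map of `Coordinates.exists_sum`. -/
theorem Coordinates.exists_normalForm [DecidableEq ι] (h : Coordinates x d)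
    (Φ : MvPolynomial ι k →ₐ[k] diffOps k B)
    (hΦ : ∀ j, Φ (MvPolynomial.X j) = ofDer k B (d j)) (P : diffOps k B) :
    ∃ c : (ι →₀ ℕ) →₀ B, P = c.sum fun α b => ofFun k B b * Φ (MvPolynomial.monomial α 1) := by
  obtain ⟨c, hc⟩ := h.exists_sum (B := B) Φ hΦ (1 ⊗ₜ P)
  refine ⟨c, ?_⟩
  have h1 := congrArg (TensorProduct.lid B (diffOps k B)) hc
  rw [TensorProduct.lid_tmul, one_smul] at h1
  rw [h1, Finsupp.sum]
  refine (map_sum (TensorProduct.lid B (diffOps k B)).toLinearMap.toAddMonoidHom _ _).trans ?_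
  exact Finset.sum_congr rfl fun α _ => TensorProduct.lid_tmul _ _

namespace PolyTransfer

variable {lam : Type*}

/-- The degree of `η^γ` in the variables that belong to the coordinates of `B`. -/
def leftDegree (γ : ι ⊕ lam →₀ ℕ) : ℕ := ∑ i, γ (Sum.inl i)

theorem leftDegree_add (γ δ : ι ⊕ lam →₀ ℕ) :
    leftDegree (γ + δ) = leftDegree γ + leftDegree δ := by
  simp [leftDegree, Finset.sum_add_distrib]

theorem leftDegree_single_inl (i : ι) :
    leftDegree (Finsupp.single (Sum.inl i) 1 : ι ⊕ lam →₀ ℕ) = 1 := by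
  classical simp [leftDegree, Finsupp.single_apply]

theorem leftDegree_single_inr (j : lam) :
    leftDegree (Finsupp.single (Sum.inr j) 1 : ι ⊕ lam →₀ ℕ) = 0 := by
  simp [leftDegree]

theorem leftDegree_sumElim (α : ι →₀ ℕ) (β : lam →₀ ℕ) :
    leftDegree (Finsupp.sumElim α β) = α.degree := by
  simp [leftDegree, Finsupp.degree_eq_sum]

/-- The elements of degree less than `n` in the variables that belong to the coordinates of `B`. -/
noncomputable def low (g : ι ⊕ lam → B) (n : ℕ) : AddSubgroup (PolyTransfer g) :=
  AddSubgroup.closure {p | ∃ γ b, leftDegree γ < n ∧ p = mon g γ b}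

theorem mon_mem_low (g : ι ⊕ lam → B) {n : ℕ} {γ : ι ⊕ lam →₀ ℕ} (h : leftDegree γ < n) (b : B) :
    mon g γ b ∈ low g n :=
  AddSubgroup.subset_closure ⟨γ, b, h, rfl⟩

theorem coeff_eq_zero_of_mem_low {g : ι ⊕ lam → B} {n : ℕ} {p : PolyTransfer g} (hp : p ∈ low g n)
    {γ : ι ⊕ lam →₀ ℕ} (hγ : n ≤ leftDegree γ) : coeff γ p = 0 := by
  induction hp using AddSubgroup.closure_induction with
  | mem q hq =>
    obtain ⟨δ, b, hδ, rfl⟩ := hq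
    exact coeff_mon_of_ne (fun h => (hδ.trans_le hγ).ne (congrArg leftDegree h)) b
  | zero => exact map_zero _
  | add q r _ _ hq hr => rw [map_add, hq, hr, add_zero]
  | neg q _ hq => rw [map_neg, hq, neg_zero]

variable [Fintype lam] [CharZero k]

theorem coeff_ofFun_smul {σ : Type*} [Fintype σ] {g : σ → B} (γ : σ →₀ ℕ) (b : B)
    (p : PolyTransfer g) : coeff γ (ofFun k B b • p) = b * coeff γ p := by
  induction p using induction with
  | h0 => simp
  | hadd p q hp hq => rw [smul_add, map_add, hp, hq, map_add, mul_add]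
  | hmon β c =>
    rw [ofFun_smul_mon]
    rcases eq_or_ne β γ with rfl | hne
    · rw [coeff_mon_self, coeff_mon_self]
    · rw [coeff_mon_of_ne hne, coeff_mon_of_ne hne, mul_zero]

theorem ofDer_smul_mem_low {g : ι ⊕ lam → B} {n : ℕ} {p : PolyTransfer g} (hp : p ∈ low g n)
    (v : Derivation k B B) : ofDer k B v • p ∈ low g (n + 1) := by
  induction hp using AddSubgroup.closure_induction with
  | mem q hq =>
    obtain ⟨γ, b, hγ, rfl⟩ := hq
    rw [ofDer_smul_mon]
    refine add_mem (mon_mem_low g (by omega) _) (sum_mem fun j _ => mon_mem_low g ?_ _)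
    rw [leftDegree_add]
    cases j with
    | inl i => rw [leftDegree_single_inl]; omega
    | inr j => rw [leftDegree_single_inr]; omega
  | zero => rw [smul_zero]; exact zero_mem _
  | add q r _ _ hq hr => rw [smul_add]; exact add_mem hq hr
  | neg q _ hq => rw [smul_neg]; exact neg_mem hq

variable [DecidableEq ι]

theorem ofDer_smul_mon_sumElim (hx : ∀ i j, d i (x j) = if i = j then 1 else 0) (f : lam → B)
    (i : ι) (γ : ι ⊕ lam →₀ ℕ) (b : B) :
    ofDer k B (d i) • mon (Sum.elim x f) γ b =
      mon (Sum.elim x f) (γ + Finsupp.single (Sum.inl i) 1) b + (mon (Sum.elim x f) γ (d i b) +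
        ∑ j, mon (Sum.elim x f) (γ + Finsupp.single (Sum.inr j) 1) (b * d i (f j))) := by
  rw [ofDer_smul_mon, Fintype.sum_sum_type, Finset.sum_eq_single i, add_left_comm]
  · simp [hx]
  · intro j _ hj
    simp [hx, hj.symm]
  · exact fun hi => absurd (Finset.mem_univ i) hi

/-- The action of `∂^α` on `η^β` is unitriangular: the leading term is `η^α η^β`. -/
theorem polyHom_smul_mon (hx : ∀ i j, d i (x j) = if i = j then 1 else 0) (f : lam → B)
    (Φ : MvPolynomial ι k →ₐ[k] diffOps k B)
    (hΦ : ∀ j, Φ (MvPolynomial.X j) = ofDer k B (d j)) (α : ι →₀ ℕ) (β : lam →₀ ℕ) :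
    ∃ r ∈ low (Sum.elim x f) α.degree,
      Φ (MvPolynomial.monomial α 1) • mon (Sum.elim x f) (Finsupp.sumElim 0 β) 1 =
        mon (Sum.elim x f) (Finsupp.sumElim α β) 1 + r := by
  induction hn : α.degree generalizing α with
  | zero =>
    rw [Finsupp.degree_eq_zero_iff] at hn
    subst hn
    refine ⟨0, zero_mem _, ?_⟩
    have : Φ (MvPolynomial.monomial 0 1) = 1 := map_one Φ
    rw [this, one_smul, add_zero]
  | succ n ih =>
    obtain ⟨i, hi⟩ : ∃ i, α i ≠ 0 := by
      by_contra! h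
      have : α = 0 := Finsupp.ext h
      simp [this] at hn
    obtain ⟨α, rfl⟩ : ∃ α', α = α' + Finsupp.single i 1 :=
      ⟨α - Finsupp.single i 1,
        (tsub_add_cancel_of_le (by simpa using Nat.one_le_iff_ne_zero.2 hi)).symm⟩
    have hn' : α.degree = n := by simpa using hn
    obtain ⟨r, hr, he⟩ := ih α hn'
    have hmon : MvPolynomial.monomial (α + Finsupp.single i 1) (1 : k) =
        MvPolynomial.X i * MvPolynomial.monomial α 1 := by
      rw [MvPolynomial.X, MvPolynomial.monomial_mul, one_mul, add_comm]
    have hsum : Finsupp.sumElim (α + Finsupp.single i 1) β =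
        Finsupp.sumElim α β + Finsupp.single (Sum.inl i) 1 := by
      classical
      ext (j | j)
      · simp [Finsupp.single_apply]
      · simp
    rw [hmon, map_mul, mul_smul, he, hΦ, smul_add, ofDer_smul_mon_sumElim hx, hsum, add_assoc]
    refine ⟨_, ?_, rfl⟩
    have hlow : leftDegree (Finsupp.sumElim α β) < n + 1 := by
      rw [leftDegree_sumElim, hn']
      exact Nat.lt_succ_self n
    refine add_mem (add_mem (mon_mem_low _ hlow _) (sum_mem fun j _ => mon_mem_low _ ?_ _))
      (ofDer_smul_mem_low hr _)
    rwa [leftDegree_add, leftDegree_single_inr, add_zero]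

/-- The map from a free module that takes its basis to the monomials in the variables that do not
belong to the coordinates of `B`. -/
noncomputable def freeMap (k : Type*) [Field k] [CharZero k] [Algebra k B] (g : ι ⊕ lam → B) :
    ((lam →₀ ℕ) →₀ diffOps k B) →ₗ[diffOps k B] PolyTransfer g :=
  Finsupp.linearCombination (diffOps k B) fun β => mon g (Finsupp.sumElim 0 β) 1

/-- As `∂_i • η^γ` is `η_i η^γ` plus terms of the same degree as `η^γ` in the variables that belong to
the coordinates, all monomials are obtained by induction on that degree. -/
theorem freeMap_surjective (hx : ∀ i j, d i (x j) = if i = j then 1 else 0) (f : lam → B) :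
    Function.Surjective (freeMap k (Sum.elim x f)) := by
  rw [← LinearMap.range_eq_top, eq_top_iff]
  rintro p -
  suffices ∀ n γ b, leftDegree γ = n →
      mon (Sum.elim x f) γ b ∈ LinearMap.range (freeMap k (Sum.elim x f)) by
    induction p using induction with
    | h0 => exact zero_mem _
    | hadd p q hp hq => exact add_mem hp hq
    | hmon γ b => exact this _ γ b rfl
  intro n
  induction n with
  | zero =>
    intro γ b hγ
    have h0 : ∀ i, γ (Sum.inl i) = 0 := by simpa [leftDegree] using hγ
    refine ⟨Finsupp.single (γ.comapDomain Sum.inr Sum.inr_injective.injOn) (ofFun k B b), ?_⟩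
    rw [freeMap, Finsupp.linearCombination_single, ofFun_smul_mon, mul_one]
    congr 2
    ext (i | j)
    · simp [h0]
    · simp
  | succ n ih =>
    intro γ b hγ
    obtain ⟨i, hi⟩ : ∃ i, γ (Sum.inl i) ≠ 0 := by
      by_contra! h
      simp [leftDegree, h] at hγ
    obtain ⟨γ, rfl⟩ : ∃ γ', γ = γ' + Finsupp.single (Sum.inl i) 1 :=
      ⟨γ - Finsupp.single (Sum.inl i) 1,
        (tsub_add_cancel_of_le (by simpa using Nat.one_le_iff_ne_zero.2 hi)).symm⟩
    rw [leftDegree_add, leftDegree_single_inl, add_left_inj] at hγ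
    have h1 := eq_sub_of_add_eq (ofDer_smul_mon_sumElim (k := k) hx f i γ b).symm
    rw [h1]
    refine sub_mem (Submodule.smul_mem _ _ (ih γ b hγ)) (add_mem (ih γ _ hγ)
      (sum_mem fun j _ => ih _ _ ?_))
    rw [leftDegree_add, leftDegree_single_inr, add_zero, hγ]

theorem freeMap_injective (h : Coordinates x d) (f : lam → B) :
    Function.Injective (freeMap k (Sum.elim x f)) := by
  obtain ⟨Φ, hΦ⟩ := exists_polyHom (k := k) (fun j => ofDer k B (d j)) h.commute
  rw [injective_iff_map_eq_zero]
  intro s hs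
  choose c hc using fun β => h.exists_normalForm Φ hΦ (s β)
  choose r hr he using polyHom_smul_mon (k := k) h.apply_eq f Φ hΦ
  by_contra hne
  obtain ⟨β₁, hβ₁⟩ := Finsupp.support_nonempty_iff.2 hne
  have hne₁ : (c β₁).support.Nonempty := by
    rw [Finsupp.support_nonempty_iff]
    intro h0
    have := hc β₁
    rw [h0, Finsupp.sum_zero_index] at this
    exact Finsupp.mem_support_iff.1 hβ₁ this
  obtain ⟨α₁, hα₁⟩ := hne₁
  -- the coefficient of a term of the highest order in `s` survives
  obtain ⟨⟨β, α⟩, hm, hmax⟩ := (s.support.sigma fun β => (c β).support).exists_max_image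
    (fun q => q.2.degree) ⟨⟨β₁, α₁⟩, Finset.mem_sigma.2 ⟨hβ₁, hα₁⟩⟩
  have hsum : freeMap k (Sum.elim x f) s = ∑ q ∈ s.support.sigma fun β => (c β).support,
      ofFun k B (c q.1 q.2) •
        (mon (Sum.elim x f) (Finsupp.sumElim q.2 q.1) 1 + r q.2 q.1) := by
    rw [Finset.sum_sigma, freeMap, Finsupp.linearCombination_apply, Finsupp.sum]
    refine Finset.sum_congr rfl fun β _ => ?_
    rw [hc β, Finsupp.sum, Finset.sum_smul]
    exact Finset.sum_congr rfl fun α _ => by rw [mul_smul, he]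
  have hcoeff := congrArg (coeff (Finsupp.sumElim α β)) (hsum.symm.trans hs)
  rw [map_zero, map_sum, Finset.sum_eq_single ⟨β, α⟩] at hcoeff
  · rw [coeff_ofFun_smul, map_add, coeff_mon_self,
      coeff_eq_zero_of_mem_low (hr α β) (leftDegree_sumElim α β).ge, add_zero, mul_one] at hcoeff
    exact Finsupp.mem_support_iff.1 (Finset.mem_sigma.1 hm).2 hcoeff
  · rintro ⟨β', α'⟩ hq hqne
    have hne : Finsupp.sumElim α' β' ≠ Finsupp.sumElim α β := fun hE => hqne <| by
      have h1 : α' = α := Finsupp.ext fun i => by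
        simpa using DFunLike.congr_fun hE (Sum.inl i)
      have h2 : β' = β := Finsupp.ext fun j => by
        simpa using DFunLike.congr_fun hE (Sum.inr j)
      rw [h1, h2]
    rw [coeff_ofFun_smul, map_add, coeff_mon_of_ne hne, coeff_eq_zero_of_mem_low (hr α' β'),
      add_zero, mul_zero]
    rw [leftDegree_sumElim]
    exact hmax _ hq
  · exact fun hn => absurd hm hn

/-- If coordinates of `B` are among the components, the transfer module is free. -/
theorem projective_of_coordinates (h : Coordinates x d) (f : lam → B) :
    Module.Projective (diffOps k B) (PolyTransfer (Sum.elim x f)) :=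
  Module.Projective.of_equiv
    (LinearEquiv.ofBijective _ ⟨freeMap_injective h f, freeMap_surjective h.apply_eq f⟩)

end PolyTransfer

end Immersion

/-! ### Change of coordinates -/

/-- Functions with an invertible Jacobian matrix are coordinates. -/
theorem Coordinates.exists_of_isUnit_det {k B : Type*} [Field k] [CommRing B] [Algebra k B]
    {ι : Type*} [DecidableEq ι] [Fintype ι] {x : ι → B} {d : ι → Derivation k B B}
    (h : Coordinates x d) (x' : ι → B) (hJ : IsUnit (Matrix.of fun i j => d i (x' j)).det) :
    ∃ d' : ι → Derivation k B B, Coordinates x' d' := by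
  set J : Matrix ι ι B := Matrix.of fun i j => d i (x' j) with hJdef
  have hsum : ∀ (u : ι → B) (p : B), (∑ l, u l • d l) p = ∑ l, u l * d l p := by
    intro u p
    rw [← Derivation.coeFnAddMonoidHom_apply, map_sum, Finset.sum_apply]
    simp
  refine ⟨fun i => ∑ l, J⁻¹ i l • d l, fun i j => ?_, fun v hv => h.separated v ?_⟩
  · rw [hsum, ← Matrix.one_apply, ← Matrix.nonsing_inv_mul J hJ, Matrix.mul_apply]
    rfl
  · have h0 : Matrix.vecMul (fun l => v (x l)) J = 0 := by
      funext j
      have := hv j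
      rw [h.der_eq v, hsum] at this
      exact this
    have h1 : (fun l => v (x l)) = 0 := by
      rw [← Matrix.vecMul_one (fun l => v (x l)), ← Matrix.mul_nonsing_inv J hJ,
        ← Matrix.vecMul_vecMul, h0, Matrix.zero_vecMul]
    exact fun j => congrFun h1 j

/-- Bases in which `T` has the block form `(1, 0; 0, 0)`. They come from a complement of the kernel,
which `T` maps isomorphically to its range, and from a complement of the range. -/
theorem exists_adapted_bases {K V W : Type*} [Field K] [AddCommGroup V] [Module K V]
    [FiniteDimensional K V] [AddCommGroup W] [Module K W] [FiniteDimensional K W] (T : V →ₗ[K] W) :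
    ∃ (r s t : ℕ) (b : Module.Basis (Fin r ⊕ Fin s) K V) (c : Module.Basis (Fin r ⊕ Fin t) K W),
      (∀ i, T (b (Sum.inl i)) = c (Sum.inl i)) ∧ (∀ i, T (b (Sum.inr i)) = 0) ∧
      r = Module.finrank K (LinearMap.range T) ∧ s + r = Module.finrank K V := by
  obtain ⟨C, hC⟩ := (LinearMap.ker T).exists_isCompl
  obtain ⟨D, hD⟩ := (LinearMap.range T).exists_isCompl
  let e : C ≃ₗ[K] LinearMap.range T := T.kerComplementEquivRange hC.symm
  let bC := Module.finBasis K C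
  refine ⟨_, _, _, (bC.prod (Module.finBasis K (LinearMap.ker T))).map
    (Submodule.prodEquivOfIsCompl _ _ hC.symm),
    ((bC.map e).prod (Module.finBasis K D)).map (Submodule.prodEquivOfIsCompl _ _ hD),
    fun i => ?_, fun i => ?_, e.finrank_eq, ?_⟩
  · simp [e]
  · simp
  · rw [e.finrank_eq, add_comm, LinearMap.finrank_range_add_finrank_ker]

/-! ### Jacobians of germs -/

section Jacobian

variable {E : Type*} [NormedAddCommGroup E] [NormedSpace ℂ E]
  {F : Type*} [NormedAddCommGroup F] [NormedSpace ℂ F]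
  {X : Type*} [TopologicalSpace X] [ChartedSpace E X]
  {Y : Type*} [TopologicalSpace Y] [ChartedSpace F Y]

/-- The value of a germ at the base point. -/
def germValue (x : X) : holGerms E x →+* ℂ :=
  (Germ.valueRingHom (X := X) (E := ℂ) (x := x)).comp (holGerms E x).val.toRingHom

variable [IsManifold 𝓘(ℂ, E) ω X] {x : X}

theorem germValue_ofChart {G : E → ℂ} (hG : AnalyticAt ℂ G (extChartAt 𝓘(ℂ, E) x x)) :
    germValue x (ofChart G hG) = G (extChartAt 𝓘(ℂ, E) x x) := rfl

theorem isUnit_of_germValue_ne_zero {p : holGerms E x} (hp : germValue x p ≠ 0) : IsUnit p := by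
  obtain ⟨G, hG, rfl⟩ := exists_ofChart p
  rw [germValue_ofChart] at hp
  refine IsUnit.of_mul_eq_one (ofChart (G⁻¹) (hG.inv hp)) ?_
  rw [ofChart_mul, ← map_one (algebraMap ℂ (holGerms E x)), ← ofChart_const, ofChart_inj]
  filter_upwards [hG.continuousAt.eventually_ne hp] with z hz
  exact mul_inv_cancel₀ hz

variable [FiniteDimensional ℂ E] [FiniteDimensional ℂ F] [IsManifold 𝓘(ℂ, F) ω Y]

/-- The matrix of the partial derivatives of the components of `f` has the matrix of `df(x)` as its
value at `x`. -/
theorem germValue_dirDer_pullback {f : X → Y} (hf : ContMDiffAt 𝓘(ℂ, E) 𝓘(ℂ, F) ω f x)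
    {ι : Type*} (c : Module.Basis ι ℂ F) (j : ι) (v : E) :
    germValue x (dirDer x v (pullback hf (coordGerm (f x) c j))) =
      c.coord j (mfderiv 𝓘(ℂ, E) 𝓘(ℂ, F) f x v) := by
  set e := extChartAt 𝓘(ℂ, E) x x with he
  let W : E → F := writtenInExtChartAt 𝓘(ℂ, E) 𝓘(ℂ, F) x f
  have hW : AnalyticAt ℂ W e := by
    have h := (contMDiffAt_iff.1 hf).2
    rw [modelWithCornersSelf_coe, Set.range_id, contDiffWithinAt_univ] at h
    exact h.analyticAt
  let L : F →L[ℂ] ℂ := LinearMap.toContinuousLinearMap (c.coord j)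
  have hG : AnalyticAt ℂ (fun z => L (W z - extChartAt 𝓘(ℂ, F) (f x) (f x))) e :=
    (L.analyticAt _).comp (hW.sub analyticAt_const)
  have hp : pullback hf (coordGerm (f x) c j) = ofChart _ hG := by
    refine Subtype.ext (Germ.coe_eq.2 ?_)
    filter_upwards [extChartAt_source_mem_nhds (I := 𝓘(ℂ, E)) x] with z hz
    have hz' := (extChartAt 𝓘(ℂ, E) x).left_inv hz
    simp only [Function.comp_apply, W, writtenInExtChartAt, hz']
    rfl
  rw [hp]
  refine (congrArg (germValue x) (dirFun_ofChart v hG)).trans ?_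
  rw [germValue_ofChart]
  have hmf : mfderiv 𝓘(ℂ, E) 𝓘(ℂ, F) f x = fderiv ℂ W e := by
    refine (hf.mdifferentiableAt (by simp)).mfderiv.trans ?_
    rw [modelWithCornersSelf_coe, Set.range_id, fderivWithin_univ]
  rw [hmf]
  have hd : HasFDerivAt (fun z => L (W z - extChartAt 𝓘(ℂ, F) (f x) (f x)))
      (L.comp (fderiv ℂ W e)) e :=
    L.hasFDerivAt.comp e (hW.differentiableAt.hasFDerivAt.sub_const _)
  rw [hd.fderiv]
  rfl

end Jacobian

/-! ### The flat dimension -/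

section Main

open CategoryTheory

universe uX uY

variable {E : Type*} [NormedAddCommGroup E] [NormedSpace ℂ E] [FiniteDimensional ℂ E]
  {F : Type*} [NormedAddCommGroup F] [NormedSpace ℂ F] [FiniteDimensional ℂ F]
  {X : Type uX} [TopologicalSpace X] [ChartedSpace E X] [IsManifold 𝓘(ℂ, E) ω X]
  {Y : Type uY} [TopologicalSpace Y] [ChartedSpace F Y] [IsManifold 𝓘(ℂ, F) ω Y]
  {f : X → Y} {x : X}

theorem nonempty_polyTransfer_equiv_transferModule {ι : Type*} [DecidableEq ι] [Fintype ι]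
    (hf : ContMDiffAt 𝓘(ℂ, E) 𝓘(ℂ, F) ω f x) (c : Module.Basis ι ℂ F) :
    Nonempty (PolyTransfer (fun j => pullback hf (coordGerm (f x) c j))
      ≃ₗ[DiffOpGerms E x] TransferModule hf) := by
  let := pullbackAlgebra hf
  have := pullback_tower hf
  refine (coordinates c).nonempty_equiv_polyTransfer (fun w hw => ?_) (hasTransferAction hf)
  refine Derivation.ext fun p => ?_
  exact eq_zero_of_leibniz c (pullback hf) (vanishOrder_pullback hf _)
    w.toLinearMap w.map_one_eq_zero (fun p q => w.leibniz p q) hw p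

/-- In bases adapted to `df(x)`, the first components of `f` and the last coordinates of `X` have
the identity as Jacobian matrix at `x`. -/
theorem exists_coordinates_sumElim {r s t : ℕ} (hf : ContMDiffAt 𝓘(ℂ, E) 𝓘(ℂ, F) ω f x)
    (b : Module.Basis (Fin r ⊕ Fin s) ℂ E) (c : Module.Basis (Fin r ⊕ Fin t) ℂ F)
    (hl : ∀ i, mfderiv 𝓘(ℂ, E) 𝓘(ℂ, F) f x (b (Sum.inl i)) = c (Sum.inl i))
    (hr : ∀ i, mfderiv 𝓘(ℂ, E) 𝓘(ℂ, F) f x (b (Sum.inr i)) = 0) :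
    ∃ d, Coordinates (k := ℂ) (Sum.elim
      (fun i => pullback hf (coordGerm (f x) c (Sum.inl i)))
      fun i => coordGerm x b (Sum.inr i)) d := by
  refine (coordinates (x := x) b).exists_of_isUnit_det _ (isUnit_of_germValue_ne_zero ?_)
  rw [RingHom.map_det]
  suffices h : (germValue x).mapMatrix (Matrix.of fun i j => dirDer x (b i) (Sum.elim
      (fun i => pullback hf (coordGerm (f x) c (Sum.inl i)))
      (fun i => coordGerm x b (Sum.inr i)) j)) = 1 by
    rw [h, Matrix.det_one]
    exact one_ne_zero
  ext i j
  rw [RingHom.mapMatrix_apply, Matrix.map_apply, Matrix.of_apply, Matrix.one_apply]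
  rcases j with j | j
  · rw [Sum.elim_inl, germValue_dirDer_pullback]
    rcases i with i | i
    · rw [hl]
      simp [Finsupp.single_apply]
    · rw [hr]
      refine (map_zero (c.coord (Sum.inl j))).trans ?_
      simp
  · rw [Sum.elim_inr, dirDer_coordGerm]
    split_ifs <;> simp

/-- The rank of `df(x)` many components of `f` are part of a system of coordinates at `x`. Adding
the `s` missing coordinates to the components of `f` yields an immersion. -/
theorem hasProjectiveDimensionLT_transferModule {r s t : ℕ}
    (hf : ContMDiffAt 𝓘(ℂ, E) 𝓘(ℂ, F) ω f x)
    (b : Module.Basis (Fin r ⊕ Fin s) ℂ E) (c : Module.Basis (Fin r ⊕ Fin t) ℂ F)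
    (hl : ∀ i, mfderiv 𝓘(ℂ, E) 𝓘(ℂ, F) f x (b (Sum.inl i)) = c (Sum.inl i))
    (hr : ∀ i, mfderiv 𝓘(ℂ, E) 𝓘(ℂ, F) f x (b (Sum.inr i)) = 0) :
    HasProjectiveDimensionLT (ModuleCat.of (DiffOpGerms E x) (TransferModule hf)) (s + 1) := by
  obtain ⟨d, hd⟩ := exists_coordinates_sumElim hf b c hl hr
  obtain ⟨e⟩ := nonempty_polyTransfer_equiv_transferModule hf c
  let g := fun j => pullback hf (coordGerm (f x) c j)
  -- the index type is lifted to bring the modules into the same universe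
  let g' : ULift.{uY} (Fin r ⊕ Fin t) → holGerms E x := fun j => g j.down
  let σ : (Fin r ⊕ Fin s) ⊕ Fin t ≃ ULift.{uY} (Fin r ⊕ Fin t) ⊕ Fin s :=
    (Equiv.sumAssoc _ _ _).trans <| (Equiv.sumCongr (Equiv.refl _) (Equiv.sumComm _ _)).trans <|
      (Equiv.sumAssoc _ _ _).symm.trans <| Equiv.sumCongr Equiv.ulift.symm (Equiv.refl _)
  have hp := PolyTransfer.projective_of_coordinates hd fun j => g (Sum.inr j)
  have hp' : Module.Projective (DiffOpGerms E x)
      (PolyTransfer (Sum.elim g' fun i => coordGerm x b (Sum.inr i))) := by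
    refine Module.Projective.of_equiv (PolyTransfer.reindex (k := ℂ) σ (g := Sum.elim (Sum.elim
      (fun i => g (Sum.inl i)) fun i => coordGerm x b (Sum.inr i)) fun j => g (Sum.inr j))
      fun a => ?_)
    rcases a with (i | i) | j <;> rfl
  have h := PolyTransfer.hasProjectiveDimensionLT_of_projective s g' _ hp'
  let e' : PolyTransfer g' ≃ₗ[DiffOpGerms E x] TransferModule hf :=
    (PolyTransfer.reindex (k := ℂ) Equiv.ulift fun _ => rfl).trans e
  exact hasProjectiveDimensionLT_of_iso e'.toModuleIso _

theorem flatDim_transferModule_add_rankAt_le (hf : ContMDiffAt 𝓘(ℂ, E) 𝓘(ℂ, F) ω f x) :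
    flatDim (DiffOpGerms E x) (TransferModule hf) + (rankAt (E := E) (F := F) f x : ℕ∞) ≤
      (Module.finrank ℂ E : ℕ∞) := by
  let T : E →L[ℂ] F := mfderiv 𝓘(ℂ, E) 𝓘(ℂ, F) f x
  obtain ⟨r, s, t, b, c, hl, hr, hrank, hdim⟩ := exists_adapted_bases T.toLinearMap
  have h := flatDim_le.{uX, uY} s (TransferModule hf)
    (hasProjectiveDimensionLT_transferModule hf b c hl hr)
  have hrank' : rankAt (E := E) (F := F) f x = r := hrank.symm
  rw [hrank', ← hdim, Nat.cast_add]
  gcongr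

end Main

end DiffOp

theorem mainTheorem11
    {E : Type*} [NormedAddCommGroup E] [NormedSpace ℂ E] [FiniteDimensional ℂ E]
    {F : Type*} [NormedAddCommGroup F] [NormedSpace ℂ F] [FiniteDimensional ℂ F]
    {X : Type*} [TopologicalSpace X] [ChartedSpace E X] [IsManifold 𝓘(ℂ, E) ω X]
    {Y : Type*} [TopologicalSpace Y] [ChartedSpace F Y] [IsManifold 𝓘(ℂ, F) ω Y]
    (f : X → Y) (hf : ContMDiff 𝓘(ℂ, E) 𝓘(ℂ, F) ω f) (x₀ : X) :
    DiffOp.flatDim (DiffOp.DiffOpGerms E x₀) (DiffOp.TransferModule (hf x₀)) +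
        (DiffOp.rankAt (E := E) (F := F) f x₀ : ℕ∞) ≤ (Module.finrank ℂ E : ℕ∞) :=
  DiffOp.flatDim_transferModule_add_rankAt_le (hf x₀)
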